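/- A function $f_0:\mathbb{R}\to[0,\infty)$ that is a probability density with respect to Lebesgue measure and is absolutely continuous on every compact interval is called a locally absolutely continuous density. For $\beta\in[1,2]$ and $L,r>0$, let $\tilde{\mathcal F}_{\beta,L,r}$ be the set of all positive, locally absolutely continuous densities $f_0$ on $\mathbb{R}$ (not necessarily log-concave) whose score function $\psi_0:=(\log f_0)'$ (defined everywhere if $\beta>1$, and Lebesgue almost everywhere if $\beta=1$) satisfies $$|\psi_0(x)-\psi_0(y)|\le L|x-y|^{\beta-1}$$ for all $x,y\in\mathbb{R}$ at which it is defined, and whose Fisher information satisfies $i(f_0):=\int_{-\infty}^{\infty}\psi_0^2f_0\le r$. For $n\in\mathbb{N}=\{1,2,\dots\}$, let $\hat\Psi_n$ be the set of all jointly measurable functions $\hat\psi_n:\mathbb{R}\times\mathbb{R}^n\to\mathbb{R}$, and let $X_1,\dots,X_n$ be independent random variables with density $f_0$. Write $$\mathcal{L}_{f_0}(\hat\psi_n):=\int_{-\infty}^{\infty}\bigl(\hat\psi_n(x;X_1,\dots,X_n)-\psi_0(x)\bigr)^2f_0(x)\,\mathrm{d}x\in[0,\infty].$$ For a class $\mathcal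 G$ of such densities and $\delta\in(0,1]$, define the minimax risk and the minimax $(1-\delta)$th quantile over $\mathcal G$ by $$\mathcal M_n(\mathcal G):=\inf_{\hat\psi_n\in\hat\Psi_n}\sup_{f_0\in\mathcal G}\mathbb{E}_{f_0}\bigl\{\mathcal{L}_{f_0}(\hat\psi_n)\bigr\},$$ $$\mathcal M_n(\delta,\mathcal G):=\inf_{\hat\psi_n\in\hat\Psi_n}\sup_{f_0\in\mathcal G}\inf\bigl\{t\in[0,\infty):\mathbb{P}_{f_0}\bigl(\mathcal{L}_{f_0}(\hat\psi_n)\le t\bigr)\ge1-\delta\bigr\},$$ with $\inf\emptyset:=\infty$. Then for every $\beta\in[1,2]$ there is a constant $c_\beta>0$, depending only on $\beta$, such that for all $L,r>0$, all $n\in\mathbb{N}$ and all $\delta\in(0,1/4)$, with $r':=\min\{r,L^{2/\beta}\}$, $$\mathcal M_n(\delta,\tilde{\mathcal F}_{\beta,L,r})\ge c_\beta\, r'\min\biggl\{\Bigl(\frac{L^{2/\beta}}{r'}\cdot\frac1n\Bigr)^{\frac{2(\beta-1)}{2\beta+1}}+\Bigl(\frac{L^{2/\beta}}{r'}\cdot\frac{\log(1/\delta)}{n}\Bigr)^{\frac{\beta-1}{\beta}},\,1\biggr\},$$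 $$\mathcal M_n(\tilde{\mathcal F}_{\beta,L,r})\ge c_\beta\, r'\min\biggl\{\Bigl(\frac{L^{2/\beta}}{r'}\cdot\frac1n\Bigr)^{\frac{2(\beta-1)}{2\beta+1}},\,1\biggr\}.$$ -/

import Mathlib

open MeasureTheory
open scoped ENNReal NNReal

/-- `f` is a probability density on `ℝ` with respect to Lebesgue measure. -/
def IsDensity (f : ℝ → ℝ) : Prop :=
  Measurable f ∧ (∀ x, 0 ≤ f x) ∧ ∫⁻ x, ENNReal.ofReal (f x) = 1

/-- Local absolute continuity on `ℝ`: absolute continuity on every compact interval. -/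
def LocallyAbsCont (f : ℝ → ℝ) : Prop :=
  ∀ a b : ℝ, AbsolutelyContinuousOnInterval f a b

/-- The score function `(log f)'`. For a positive, locally absolutely continuous `f` the derivative
exists at Lebesgue almost every point; the value at the other points is immaterial, since the score
is only used under integrals, or at points where the derivative exists. -/
noncomputable def score (f : ℝ → ℝ) (x : ℝ) : ℝ :=
  deriv (fun y => Real.log (f y)) x

/-- The Fisher information for location, `∫ ψ₀² f₀`, as an extended nonnegative real. -/
noncomputable def fisherInfo (f : ℝ → ℝ) : ℝ≥0∞ :=
  ∫⁻ x, ENNReal.ofReal (score f x ^ 2 * f x)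

/-- The class of locally absolutely continuous densities on `ℝ` whose score function satisfies
`|ψ₀(x) - ψ₀(y)| ≤ L |x - y| ^ (β - 1)` for all `x, y`. The density is positive, so that its
logarithm is real valued. The score has to be defined everywhere when `β > 1`; when `β = 1` it is
defined almost everywhere, and the condition ranges over the points where it is defined. -/
def holderScoreClass (β L : ℝ) : Set (ℝ → ℝ) :=
  {f | IsDensity f ∧ (∀ x, 0 < f x) ∧ LocallyAbsCont f ∧
    (1 < β → Differentiable ℝ (fun y => Real.log (f y))) ∧
    ∀ x y : ℝ, DifferentiableAt ℝ (fun z => Real.log (f z)) x →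
      DifferentiableAt ℝ (fun z => Real.log (f z)) y →
      |score f x - score f y| ≤ L * |x - y| ^ (β - 1)}

/-- The subclass with Fisher information at most `r`. -/
def holderScoreFisherClass (β L r : ℝ) : Set (ℝ → ℝ) :=
  {f | f ∈ holderScoreClass β L ∧ fisherInfo f ≤ ENNReal.ofReal r}

/-- The law of `n` independent observations with density `f`. -/
noncomputable def sampleLaw (n : ℕ) (f : ℝ → ℝ) : Measure (Fin n → ℝ) :=
  Measure.pi fun _ => (volume : Measure ℝ).withDensity fun x => ENNReal.ofReal (f x)

/-- The loss `∫ (ψ - ψ₀)² f₀` of a real function `ψ`, as an extended nonnegative real. -/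
noncomputable def scoreLoss (ψ f : ℝ → ℝ) : ℝ≥0∞ :=
  ∫⁻ x, ENNReal.ofReal ((ψ x - score f x) ^ 2 * f x)

/-- The estimators of the score from `n` observations: jointly measurable functions of the point
`x` and the sample. -/
def ScoreEstimator (n : ℕ) : Type :=
  {ψ : ℝ × (Fin n → ℝ) → ℝ // Measurable ψ}

/-- The loss incurred by an estimator on the sample `X`. -/
noncomputable def ScoreEstimator.loss {n : ℕ} (ψ : ScoreEstimator n) (f : ℝ → ℝ)
    (X : Fin n → ℝ) : ℝ≥0∞ :=
  scoreLoss (fun x => ψ.1 (x, X)) f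

/-- The minimax risk of score estimation over `G` (infimum over estimators of the worst-case
expected loss). -/
noncomputable def minimaxRisk (n : ℕ) (G : Set (ℝ → ℝ)) : ℝ≥0∞ :=
  ⨅ ψ : ScoreEstimator n, ⨆ f ∈ G, ∫⁻ X, ψ.loss f X ∂(sampleLaw n f)

/-- The `(1 - δ)`th quantile of the loss: the infimum of the `t ∈ [0, ∞)` such that the loss is at
most `t` with probability at least `1 - δ` (and `∞` if there is no such `t`). -/
noncomputable def lossQuantile {n : ℕ} (δ : ℝ) (ψ : ScoreEstimator n) (f : ℝ → ℝ) : ℝ≥0∞ :=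
  ⨅ (t : ℝ≥0) (_ : ENNReal.ofReal (1 - δ) ≤ sampleLaw n f {X | ψ.loss f X ≤ (t : ℝ≥0∞)}),
    (t : ℝ≥0∞)

/-- The minimax `(1 - δ)`th quantile of score estimation over `G`. -/
noncomputable def minimaxQuantile (n : ℕ) (δ : ℝ) (G : Set (ℝ → ℝ)) : ℝ≥0∞ :=
  ⨅ ψ : ScoreEstimator n, ⨆ f ∈ G, lossQuantile δ ψ f

/-! Sign patterns of small bumps around one density give many members of the class that a sample can
hardly tell apart, although their scores are well separated in mean square. Put σ = L^(1/β) and s =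
r', so that s ≤ σ². The base density has height of order a = s/(4σ) on a plateau of length 1/σ and
Cauchy tails on the scale 1/a. Its score vanishes on the plateau and is bounded and Lipschitz
elsewhere. The plateau has mass of order s/σ², so only about ns/σ² observations are informative:
this is where the factor L^(2/β)/r' comes from.

The plateau is cut into m bins of width w = 1/(σm), and the density is multiplied by exp(±A b) on
each, with A of order m^(-β), as the Hölder condition demands. The bump b is odd about the middle of
its bin, so the normalising constant ignores the signs (`lintegral_tiltedFun_eq`) and flipping one
sign changes the density on one bin only. The squared Hellinger distance is then at most aA²w
(`affinity_tiltedDensity`), whereas a wrong sign costs a loss of order aA²/w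
(`lintegral_bin_score_sq`). Over all bins the loss is of order s m^(2-2β).

The cube is used twice. With free signs and m^(2β+1) of order at least ns/σ², Assouad's lemma makes
every decoder miss a fixed fraction of the signs on average, and a reverse Markov inequality turns
this into a probability of at least 4/15 > δ; this gives the first rate. With all signs equal there
are two hypotheses; m^(2β) of order at least (ns/σ²)/log(1/δ) keeps the affinity of the samples
above δ^(1/4), so the error probability exceeds δ; this gives the deviation term for δ < 1/16. For
larger δ that term is absorbed by the first. The risk bound follows from the quantile bound by
Markov's inequality. -/

/-! ### Product laws and Hellinger affinity -/

/-- Tonelli's theorem for a product of functions of one coordinate each. -/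
theorem lintegral_fin_prod_eq_prod {n : ℕ} (μ : Fin n → Measure ℝ) [∀ i, SigmaFinite (μ i)]
    (g : Fin n → ℝ → ℝ≥0∞) (hg : ∀ i, Measurable (g i)) :
    ∫⁻ x, ∏ i, g i (x i) ∂(Measure.pi μ) = ∏ i, ∫⁻ x, g i x ∂(μ i) := by
  induction n with
  | zero => simp
  | succ n ih =>
    rw [← (measurePreserving_piFinSuccAbove μ 0).symm.lintegral_comp_emb
      (MeasurableEquiv.measurableEmbedding _)]
    simp only [Fin.prod_univ_succ, MeasurableEquiv.piFinSuccAbove_symm_apply, Fin.insertNthEquiv,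
      Fin.zero_succAbove, Equiv.coe_fn_mk, Fin.insertNth_zero, Fin.cons_zero, Fin.cons_succ]
    simp only [cast_eq]
    rw [lintegral_prod_mul (f := g 0)
      (g := fun y : Fin n → ℝ => ∏ i, g i.succ (y i)) (hg 0).aemeasurable
      (Finset.measurable_prod _ fun i _ => (hg _).comp (measurable_pi_apply i)).aemeasurable,
      ih (fun i => μ i.succ) (fun i => g i.succ) (fun i => hg _)]

theorem sampleLaw_eq_withDensity (n : ℕ) {f : ℝ → ℝ} (hf : Measurable f) :
    sampleLaw n f =
      (Measure.pi fun _ : Fin n => (volume : Measure ℝ)).withDensity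
        fun X => ∏ i, ENNReal.ofReal (f (X i)) := by
  symm
  unfold sampleLaw
  have : SigmaFinite ((volume : Measure ℝ).withDensity fun x => ENNReal.ofReal (f x)) :=
    SigmaFinite.withDensity_of_ne_top' (by simp)
  refine (Measure.pi_eq fun s hs => ?_).symm
  rw [withDensity_apply _ (MeasurableSet.univ_pi hs), ← lintegral_indicator (MeasurableSet.univ_pi hs)]
  have : ∀ X : Fin n → ℝ, (Set.univ.pi s).indicator
      (fun X => ∏ i, ENNReal.ofReal (f (X i))) X =
      ∏ i, (s i).indicator (fun x => ENNReal.ofReal (f x)) (X i) := by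
    intro X
    by_cases h : X ∈ Set.univ.pi s
    · rw [Set.indicator_of_mem h]
      exact Finset.prod_congr rfl fun i _ =>
        (Set.indicator_of_mem (h i trivial) fun x => ENNReal.ofReal (f x)).symm
    · rw [Set.indicator_of_notMem h]
      simp only [Set.mem_univ_pi, not_forall] at h
      obtain ⟨i, hi⟩ := h
      exact (Finset.prod_eq_zero (Finset.mem_univ i) (Set.indicator_of_notMem hi _)).symm
  simp_rw [this]
  rw [lintegral_fin_prod_eq_prod (fun _ => volume)
    (fun i => (s i).indicator fun x => ENNReal.ofReal (f x))
    (fun i => (hf.ennreal_ofReal).indicator (hs i))]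
  exact Finset.prod_congr rfl fun i _ => by
    rw [lintegral_indicator (hs i), withDensity_apply _ (hs i)]

theorem IsDensity.isProbabilityMeasure_sampleLaw {f : ℝ → ℝ} (hf : IsDensity f) (n : ℕ) :
    IsProbabilityMeasure (sampleLaw n f) := by
  have : IsProbabilityMeasure ((volume : Measure ℝ).withDensity fun x => ENNReal.ofReal (f x)) :=
    ⟨by rw [withDensity_apply _ MeasurableSet.univ, Measure.restrict_univ, hf.2.2]⟩
  unfold sampleLaw
  infer_instance

/-- The two error probabilities of a test are bounded below through the Hellinger affinity of the
densities. -/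
theorem affinity_pow_le_test_errors {p q : ℝ → ℝ} (hp : IsDensity p) (hq : IsDensity q) {ρ : ℝ}
    (hρ : 0 ≤ ρ) (hpq : ENNReal.ofReal ρ ≤ ∫⁻ x, ENNReal.ofReal (√(p x * q x))) (n : ℕ)
    {S : Set (Fin n → ℝ)} (hS : MeasurableSet S) {l : ℝ} (hl : 0 < l) :
    2 * ρ ^ n ≤ l⁻¹ * ((sampleLaw n p).real S + (sampleLaw n q).real Sᶜ) +
      l * (2 - ((sampleLaw n p).real S + (sampleLaw n q).real Sᶜ)) := by
  have := hp.isProbabilityMeasure_sampleLaw n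
  have := hq.isProbabilityMeasure_sampleLaw n
  obtain ⟨hpm, hp0, -⟩ := hp
  obtain ⟨hqm, hq0, -⟩ := hq
  set μ := Measure.pi fun _ : Fin n => (volume : Measure ℝ) with hμ
  set P : (Fin n → ℝ) → ℝ≥0∞ := fun X => ∏ i, ENNReal.ofReal (p (X i)) with hP
  set Q : (Fin n → ℝ) → ℝ≥0∞ := fun X => ∏ i, ENNReal.ofReal (q (X i)) with hQ
  set R : (Fin n → ℝ) → ℝ≥0∞ := fun X => ∏ i, ENNReal.ofReal (√(p (X i) * q (X i))) with hR
  have hPm : Measurable P := Finset.measurable_prod _ fun i _ =>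
    (hpm.comp (measurable_pi_apply i)).ennreal_ofReal
  have hQm : Measurable Q := Finset.measurable_prod _ fun i _ =>
    (hqm.comp (measurable_pi_apply i)).ennreal_ofReal
  have pw : ∀ c : ℝ, 0 < c → ∀ X,
      2 * R X ≤ ENNReal.ofReal c⁻¹ * P X + ENNReal.ofReal c * Q X := by
    intro c hc X
    have e1 : R X = ENNReal.ofReal ((∏ i, √(p (X i))) * ∏ i, √(q (X i))) := by
      rw [hR, ← Finset.prod_mul_distrib, ENNReal.ofReal_prod_of_nonneg (fun i _ => by positivity)]
      exact Finset.prod_congr rfl fun i _ => by rw [Real.sqrt_mul (hp0 _)]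
    have e2 : P X = ENNReal.ofReal ((∏ i, √(p (X i))) ^ 2) := by
      rw [hP, ← Finset.prod_pow, ENNReal.ofReal_prod_of_nonneg (fun i _ => by positivity)]
      exact Finset.prod_congr rfl fun i _ => by rw [Real.sq_sqrt (hp0 _)]
    have e3 : Q X = ENNReal.ofReal ((∏ i, √(q (X i))) ^ 2) := by
      rw [hQ, ← Finset.prod_pow, ENNReal.ofReal_prod_of_nonneg (fun i _ => by positivity)]
      exact Finset.prod_congr rfl fun i _ => by rw [Real.sq_sqrt (hq0 _)]
    rw [e1, e2, e3, ← ENNReal.ofReal_mul (by positivity), ← ENNReal.ofReal_mul (by positivity),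
      ← ENNReal.ofReal_add (by positivity) (by positivity), ← ENNReal.ofReal_ofNat 2,
      ← ENNReal.ofReal_mul (by norm_num)]
    apply ENNReal.ofReal_le_ofReal
    set u := ∏ i, √(p (X i))
    set v := ∏ i, √(q (X i))
    have : c⁻¹ * u ^ 2 + c * v ^ 2 - 2 * (u * v) = c⁻¹ * (u - c * v) ^ 2 := by
      field_simp
      ring
    have h2 : 0 ≤ c⁻¹ * (u - c * v) ^ 2 := by positivity
    linarith
  have key : ∀ c : ℝ, 0 < c → ∀ T : Set (Fin n → ℝ), MeasurableSet T →
      2 * ∫⁻ X in T, R X ∂μ ≤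
        ENNReal.ofReal (c⁻¹ * (sampleLaw n p).real T + c * (sampleLaw n q).real T) := by
    intro c hc T hT
    rw [ENNReal.ofReal_add (by positivity) (by positivity), ENNReal.ofReal_mul (by positivity),
      ENNReal.ofReal_mul (by positivity), ofReal_measureReal, ofReal_measureReal,
      sampleLaw_eq_withDensity n hpm, sampleLaw_eq_withDensity n hqm, withDensity_apply _ hT,
      withDensity_apply _ hT, ← lintegral_const_mul' _ _ (by simp),
      ← lintegral_const_mul _ hPm, ← lintegral_const_mul _ hQm,
      ← lintegral_add_left (hPm.const_mul _)]
    exact lintegral_mono fun X => pw c hc X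
  have hRint : ENNReal.ofReal (ρ ^ n) ≤ ∫⁻ X, R X ∂μ := by
    rw [hR, hμ, lintegral_fin_prod_eq_prod (fun _ => volume)
      (fun _ x => ENNReal.ofReal (√(p x * q x)))
      (fun _ => ((hpm.mul hqm).sqrt).ennreal_ofReal), ENNReal.ofReal_pow hρ]
    simpa using pow_le_pow_left' hpq n
  -- The weight is `l` on `S` and `l⁻¹` on its complement, so both error terms get the factor `l⁻¹`
  -- and both success terms the factor `l`. Leaving `l` free replaces an optimisation with a square
  -- root.
  have h1 := key l hl S hS
  have h2 := key l⁻¹ (by positivity) Sᶜ hS.compl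
  have h3 : ENNReal.ofReal (2 * ρ ^ n) ≤ ENNReal.ofReal
      ((l⁻¹ * (sampleLaw n p).real S + l * (sampleLaw n q).real S) +
        (l⁻¹⁻¹ * (sampleLaw n p).real Sᶜ + l⁻¹ * (sampleLaw n q).real Sᶜ)) := by
    rw [ENNReal.ofReal_add (by positivity) (by positivity)]
    refine le_trans ?_ (add_le_add h1 h2)
    rw [← mul_add, lintegral_add_compl _ hS, ENNReal.ofReal_mul (by norm_num),
      ENNReal.ofReal_ofNat]
    gcongr
  rw [ENNReal.ofReal_le_ofReal_iff (by positivity), inv_inv] at h3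
  have c1 := probReal_compl_eq_one_sub (μ := sampleLaw n p) hS
  have c2 := probReal_compl_eq_one_sub (μ := sampleLaw n q) hS
  rw [c1, c2] at h3
  rw [c2]
  linarith
-- Lower bounds for quantiles and for the risk
theorem measurable_score (f : ℝ → ℝ) : Measurable (score f) :=
  measurable_deriv _

theorem ScoreEstimator.measurable_loss {n : ℕ} (ψ : ScoreEstimator n) {f : ℝ → ℝ}
    (hf : Measurable f) : Measurable (ψ.loss f) := by
  have h : Measurable fun z : (Fin n → ℝ) × ℝ =>
      ENNReal.ofReal ((ψ.1 (z.2, z.1) - score f z.2) ^ 2 * f z.2) := by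
    have h1 : Measurable fun z : (Fin n → ℝ) × ℝ => ψ.1 (z.2, z.1) :=
      ψ.2.comp measurable_swap
    have h2 : Measurable fun z : (Fin n → ℝ) × ℝ => score f z.2 :=
      (measurable_score f).comp measurable_snd
    exact (((h1.sub h2).pow_const 2).mul (hf.comp measurable_snd)).ennreal_ofReal
  exact h.lintegral_prod_right'

theorem le_minimaxQuantile {n : ℕ} {δ : ℝ} {G : Set (ℝ → ℝ)} {t₀ : ℝ≥0∞}
    (h : ∀ ψ : ScoreEstimator n, ∀ t : ℝ≥0, (t : ℝ≥0∞) < t₀ →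
      ∃ f ∈ G, sampleLaw n f {X | ψ.loss f X ≤ t} < ENNReal.ofReal (1 - δ)) :
    t₀ ≤ minimaxQuantile n δ G := by
  refine le_iInf fun ψ => le_of_forall_lt fun s hs => ?_
  obtain ⟨t, hst, ht⟩ := ENNReal.lt_iff_exists_nnreal_btwn.1 hs
  obtain ⟨f, hfG, hf⟩ := h ψ t ht
  refine hst.trans_le (le_trans ?_ (le_iSup₂ f hfG))
  refine le_iInf₂ fun u hu => ?_
  by_contra! hut
  refine absurd (hu.trans (measure_mono fun X hX => ?_)) (not_le.2 hf)
  exact le_trans hX hut.le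

/-- Markov's inequality: for every t below the quantile the loss is at least t with probability at
least δ, so its mean is at least δt. -/
theorem ofReal_mul_minimaxQuantile_le_minimaxRisk {n : ℕ} {δ : ℝ} (hδ : 0 < δ) (hδ' : δ ≤ 1)
    {G : Set (ℝ → ℝ)} (hG : ∀ f ∈ G, IsDensity f) :
    ENNReal.ofReal δ * minimaxQuantile n δ G ≤ minimaxRisk n G := by
  refine le_iInf fun ψ => ?_
  refine le_trans (mul_le_mul_right (iInf_le _ ψ) _) ?_
  rw [ENNReal.mul_iSup]
  refine iSup_le fun f => ?_
  rw [ENNReal.mul_iSup]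
  refine iSup_le fun hf => le_trans ?_ (le_iSup₂ f hf)
  have := (hG f hf).isProbabilityMeasure_sampleLaw n
  have hm := ψ.measurable_loss (hG f hf).1
  rw [mul_comm, ← ENNReal.le_div_iff_mul_le (Or.inl (by simpa using hδ)) (Or.inl (by simp))]
  refine le_of_forall_lt fun s hs => ?_
  obtain ⟨t, hst, ht⟩ := ENNReal.lt_iff_exists_nnreal_btwn.1 hs
  refine hst.trans_le ?_
  have h1 : sampleLaw n f {X | ψ.loss f X ≤ t} < ENNReal.ofReal (1 - δ) := by
    by_contra! hc
    exact absurd (iInf₂_le t hc) (not_le.2 ht)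
  rw [ENNReal.le_div_iff_mul_le (Or.inl (by simpa using hδ)) (Or.inl (by simp))]
  refine le_trans ?_ (mul_meas_ge_le_lintegral hm t)
  gcongr
  have h2 : sampleLaw n f {X | ψ.loss f X ≤ t}ᶜ ≤ sampleLaw n f {X | t ≤ ψ.loss f X} :=
    measure_mono fun X hX => (not_le.1 (show ¬ ψ.loss f X ≤ t from hX)).le
  refine le_trans ?_ h2
  rw [prob_compl_eq_one_sub (measurableSet_le hm measurable_const)]
  refine le_trans ?_ (tsub_le_tsub_left h1.le _)
  rw [← ENNReal.ofReal_one, ← ENNReal.ofReal_sub _ (by linarith)]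
  simp

/-! ### Assouad's method -/

/-- The set of samples on which the test accepting `true` on `T` and `false` elsewhere misses the
value `b`. -/
def missSet {α : Type*} (T : Set α) (b : Bool) : Set α := bif b then Tᶜ else T

theorem missSet_not {α : Type*} (T : Set α) (b : Bool) : missSet T (!b) = (missSet T b)ᶜ := by
  cases b <;> simp [missSet]

theorem measurableSet_missSet {α : Type*} [MeasurableSpace α] {T : Set α} (hT : MeasurableSet T)
    (b : Bool) : MeasurableSet (missSet T b) := by
  cases b
  · exact hT
  · exact hT.compl

/-- Assouad's lemma for a family of probability measures indexed by a hypercube. -/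
theorem exists_card_mul_le_sum_missSet {ι Ω : Type*} [Fintype ι] [DecidableEq ι]
    [MeasurableSpace Ω] (P : (ι → Bool) → Measure Ω) (T : ι → Set Ω) {α : ℝ}
    (hα : ∀ θ j, α ≤ (P θ).real (missSet (T j) (θ j)) +
      (P (Function.update θ j (!θ j))).real (missSet (T j) (θ j))ᶜ) :
    ∃ θ, Fintype.card ι * (α / 2) ≤ ∑ j, (P θ).real (missSet (T j) (θ j)) := by
  by_contra! hc
  set F : (ι → Bool) → ι → ℝ := fun θ j => (P θ).real (missSet (T j) (θ j)) with hF
  have h1 : ∑ θ, ∑ j, F θ j < ∑ _θ : ι → Bool, Fintype.card ι * (α / 2) :=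
    Finset.sum_lt_sum_of_nonempty Finset.univ_nonempty fun θ _ => hc θ
  rw [Finset.sum_comm] at h1
  have h2 : ∀ j, ∑ _θ : ι → Bool, α / 2 ≤ ∑ θ, F θ j := by
    intro j
    -- Flipping the `j`th sign permutes the cube, so summing over the cube pairs each vertex with
    -- its neighbour; each of the two contributes `α / 2` on average.
    have hinv : Function.Involutive fun θ : ι → Bool => Function.update θ j (!θ j) := by
      intro θ
      simp
    have e : ∑ θ, F (Function.update θ j (!θ j)) j = ∑ θ, F θ j :=
      Equiv.sum_comp (hinv.toPerm _) fun θ => F θ j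
    have : ∑ _θ : ι → Bool, α ≤ ∑ θ, (F θ j + F (Function.update θ j (!θ j)) j) := by
      refine Finset.sum_le_sum fun θ _ => (hα θ j).trans_eq ?_
      simp only [hF, Function.update_self, missSet_not]
    rw [Finset.sum_add_distrib, e] at this
    rw [← Finset.sum_div]
    linarith
  have h3 := Finset.sum_le_sum fun j (_ : j ∈ Finset.univ) => h2 j
  rw [Finset.sum_comm] at h3
  simp only [Finset.sum_const, Finset.card_univ, nsmul_eq_mul] at h1 h3
  linarith

/-- From an estimator of the score one can decode a sign pattern: the loss is at least `τ` times the
number of decoding errors. -/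
theorem ScoreEstimator.exists_decoder {ι : Type*} [Fintype ι] {n : ℕ} (ψ : ScoreEstimator n)
    {f : (ι → Bool) → ℝ → ℝ} {B : ι → Set ℝ} {g : ℝ → ℝ} {κ : ℝ} {τ : ℝ≥0∞} (hκ : 0 ≤ κ)
    (hg : Measurable g) (hB : ∀ j, MeasurableSet (B j)) (hBd : Pairwise (Function.onFun Disjoint B))
    (hlow : ∀ θ j, ∀ x ∈ B j, κ ≤ f θ x)
    (hscore : ∀ θ j, ∀ x ∈ B j, score (f θ) x = (bif θ j then 1 else -1) * g x)
    (hsep : ∀ j, τ ≤ ∫⁻ x in B j, ENNReal.ofReal (κ * g x ^ 2)) :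
    ∃ T : ι → Set (Fin n → ℝ), (∀ j, MeasurableSet (T j)) ∧ ∀ θ X,
      τ * ∑ j, (missSet (T j) (θ j)).indicator 1 X ≤ ψ.loss (f θ) X := by
  obtain ⟨v, hv, hvψ⟩ : ∃ v : ℝ × (Fin n → ℝ) → ℝ, Measurable v ∧ v = ψ.1 := ⟨ψ.1, ψ.2, rfl⟩
  have hψ : ∀ θ X, ψ.loss (f θ) X =
      ∫⁻ x, ENNReal.ofReal ((v (x, X) - score (f θ) x) ^ 2 * f θ x) := by
    rw [hvψ]
    exact fun _ _ => rfl
  -- The loss on one bin against the sign `s`, with the density replaced by its lower bound `κ`, so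
  -- that it no longer depends on the other signs.
  set l : ℝ → ι → (Fin n → ℝ) → ℝ≥0∞ := fun s j X =>
    ∫⁻ x in B j, ENNReal.ofReal ((v (x, X) - s * g x) ^ 2 * κ) with hl
  have hm : ∀ s, Measurable fun z : (Fin n → ℝ) × ℝ =>
      ENNReal.ofReal ((v (z.2, z.1) - s * g z.2) ^ 2 * κ) := by
    intro s
    have h1 : Measurable fun z : (Fin n → ℝ) × ℝ => v (z.2, z.1) :=
      hv.comp measurable_swap
    exact (((h1.sub ((hg.comp measurable_snd).const_mul s)).pow_const 2).mul_const κ).ennreal_ofReal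
  -- Since (v - g)² + (v + g)² ≥ 2g², an estimate cannot be within `τ` of both signed scores.
  have hsum : ∀ j X, 2 * τ ≤ l 1 j X + l (-1) j X := by
    intro j X
    have e := lintegral_add_left (μ := volume.restrict (B j))
      ((hm 1).comp (measurable_prodMk_left (x := X)))
      fun x => ENNReal.ofReal ((v (x, X) - -1 * g x) ^ 2 * κ)
    refine le_trans ?_ e.le
    refine le_trans (mul_le_mul_right (hsep j) _) ?_
    rw [← lintegral_const_mul' _ _ (by simp)]
    refine lintegral_mono fun x => ?_
    rw [Function.comp_apply, ← ENNReal.ofReal_add (by positivity) (by positivity),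
      ← ENNReal.ofReal_ofNat 2,
      ← ENNReal.ofReal_mul (by norm_num)]
    apply ENNReal.ofReal_le_ofReal
    nlinarith [mul_nonneg hκ (sq_nonneg (v (x, X)))]
  -- Decode as `true` exactly when the loss against the positive sign is below `τ`; a wrong decoding
  -- then forces a loss of at least `τ` against the true sign.
  refine ⟨fun j => {X | l 1 j X < τ}, fun j => measurableSet_lt ?_ measurable_const,
    fun θ X => ?_⟩
  · exact (hm 1).lintegral_prod_right'
  · have h1 : ∀ j, τ * (missSet {X | l 1 j X < τ} (θ j)).indicator 1 X ≤
        l (bif θ j then 1 else -1) j X := by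
      intro j
      by_cases hX : X ∈ missSet {X | l 1 j X < τ} (θ j)
      · rw [Set.indicator_of_mem hX, Pi.one_apply, mul_one]
        cases hθ : θ j
        · rw [hθ] at hX
          change l 1 j X < τ at hX
          by_contra! hc
          refine absurd (hsum j X) (not_le.2 ?_)
          rw [two_mul]
          exact ENNReal.add_lt_add hX hc
        · rw [hθ] at hX
          exact not_lt.1 hX
      · rw [Set.indicator_of_notMem hX]
        simp
    rw [Finset.mul_sum, hψ]
    refine (Finset.sum_le_sum fun j _ => h1 j).trans ?_
    have h2 : ∀ j, l (bif θ j then 1 else -1) j X ≤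
        ∫⁻ x in B j, ENNReal.ofReal ((v (x, X) - score (f θ) x) ^ 2 * f θ x) := by
      intro j
      refine setLIntegral_mono' (hB j) fun x hx => ENNReal.ofReal_le_ofReal ?_
      rw [hscore θ j x hx]
      exact mul_le_mul_of_nonneg_left (hlow θ j x hx) (sq_nonneg _)
    refine (Finset.sum_le_sum fun j _ => h2 j).trans ?_
    rw [← tsum_fintype (L := .unconditional ι), ← lintegral_iUnion hB hBd]
    exact setLIntegral_le_lintegral _ _

/-- A hypercube of densities that are hard to tell apart but have well separated scores forces every
estimator to incur a large loss with large probability. -/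
theorem ScoreEstimator.exists_sampleLaw_loss_le {ι : Type*} [Fintype ι] [DecidableEq ι]
    {n : ℕ} (ψ : ScoreEstimator n)
    {f : (ι → Bool) → ℝ → ℝ} {B : ι → Set ℝ} {g : ℝ → ℝ} {κ : ℝ} {τ : ℝ≥0∞} (hκ : 0 ≤ κ)
    (hf : ∀ θ, IsDensity (f θ))
    (hg : Measurable g) (hB : ∀ j, MeasurableSet (B j)) (hBd : Pairwise (Function.onFun Disjoint B))
    (hlow : ∀ θ j, ∀ x ∈ B j, κ ≤ f θ x)
    (hscore : ∀ θ j, ∀ x ∈ B j, score (f θ) x = (bif θ j then 1 else -1) * g x)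
    (hsep : ∀ j, τ ≤ ∫⁻ x in B j, ENNReal.ofReal (κ * g x ^ 2)) {α : ℝ}
    (hα : ∀ θ j (S : Set (Fin n → ℝ)), MeasurableSet S → α ≤ (sampleLaw n (f θ)).real S +
      (sampleLaw n (f (Function.update θ j (!θ j)))).real Sᶜ)
    (k : ℕ) (t : ℝ≥0) (ht : (t : ℝ≥0∞) < τ * k) :
    ∃ θ, (Fintype.card ι + 1 - k) * (sampleLaw n (f θ)).real {X | ψ.loss (f θ) X ≤ t} ≤
      Fintype.card ι * (1 - α / 2) := by
  obtain ⟨T, hT, hloss⟩ := ψ.exists_decoder hκ hg hB hBd hlow hscore hsep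
  obtain ⟨θ, hθ⟩ := exists_card_mul_le_sum_missSet (fun θ => sampleLaw n (f θ)) T
    fun θ j => hα θ j _ (measurableSet_missSet (hT j) _)
  refine ⟨θ, ?_⟩
  have := (hf θ).isProbabilityMeasure_sampleLaw n
  set μ := sampleLaw n (f θ)
  set U := {X | ψ.loss (f θ) X ≤ t} with hU
  have hUm : MeasurableSet U := measurableSet_le (ψ.measurable_loss (hf θ).1) measurable_const
  have hM : ∀ j, MeasurableSet (missSet (T j) (θ j)) := fun j => measurableSet_missSet (hT j) _
  have hint : ∀ j, Integrable ((missSet (T j) (θ j)).indicator fun _ => (1 : ℝ)) μ := fun j =>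
    (integrable_const 1).indicator (hM j)
  -- Reverse Markov inequality. On `U` there are fewer than `k` decoding errors, hence at most `k -
  -- 1`, which is where the `+ 1` comes from; off `U` the error count is at most the number of
  -- signs.
  have hpt : ∀ X, U.indicator (fun _ => (Fintype.card ι + 1 - k : ℝ)) X ≤
      Fintype.card ι - ∑ j, (missSet (T j) (θ j)).indicator (fun _ => (1 : ℝ)) X := by
    intro X
    classical
    have e1 : ∑ j, (missSet (T j) (θ j)).indicator (fun _ => (1 : ℝ)) X =
        (Finset.univ.filter fun j => X ∈ missSet (T j) (θ j)).card := by
      simp [Set.indicator_apply]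
    have e2 : ∑ j, (missSet (T j) (θ j)).indicator (1 : (Fin n → ℝ) → ℝ≥0∞) X =
        (Finset.univ.filter fun j => X ∈ missSet (T j) (θ j)).card := by
      simp [Set.indicator_apply]
    rw [e1]
    by_cases hX : X ∈ U
    · rw [Set.indicator_of_mem hX]
      have h1 := (hloss θ X).trans hX
      rw [e2] at h1
      have h2 : (Finset.univ.filter fun j => X ∈ missSet (T j) (θ j)).card < k := by
        by_contra! hc
        have h3 : (k : ℝ≥0∞) ≤ (Finset.univ.filter fun j => X ∈ missSet (T j) (θ j)).card := by
          exact_mod_cast hc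
        exact absurd ((mul_le_mul_right h3 τ).trans h1) (not_le.2 ht)
      have h4 : ((Finset.univ.filter fun j => X ∈ missSet (T j) (θ j)).card : ℝ) + 1 ≤ k := by
        exact_mod_cast h2
      linarith
    · rw [Set.indicator_of_notMem hX, sub_nonneg]
      exact_mod_cast Finset.card_le_univ _
  have h5 := integral_mono ((integrable_const _).indicator hUm)
    ((integrable_const _).sub (integrable_finsetSum _ fun j _ => hint j)) hpt
  rw [integral_indicator_const _ hUm] at h5
  simp only [Pi.sub_apply] at h5
  rw [integral_sub (integrable_const _) (integrable_finsetSum _ fun j _ => hint j),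
    integral_finsetSum _ fun j _ => hint j] at h5
  simp only [integral_indicator_const _ (hM _), integral_const, probReal_univ, smul_eq_mul,
    one_mul, mul_one] at h5
  linarith
-- The bump and its signed translates
theorem hasDerivAt_max_zero_sq (x : ℝ) : HasDerivAt (fun y : ℝ => max y 0 ^ 2) (2 * max x 0) x := by
  rcases lt_trichotomy x 0 with hx | rfl | hx
  · have h : HasDerivAt (fun _ : ℝ => (0 : ℝ)) 0 x := hasDerivAt_const _ _
    rw [max_eq_right hx.le, mul_zero]
    refine h.congr_of_eventuallyEq ?_
    filter_upwards [gt_mem_nhds hx] with y hy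
    simp [max_eq_right hy.le]
  · have h : HasFDerivAt (fun y : ℝ => max y 0 ^ 2) (0 : ℝ →L[ℝ] ℝ) 0 := by
      refine Asymptotics.IsBigO.hasFDerivAt (n := 2) (Asymptotics.IsBigO.of_bound 1 ?_) (by norm_num)
      filter_upwards with y
      rw [one_mul, sub_zero, norm_pow, norm_pow, norm_norm, Real.norm_eq_abs, Real.norm_eq_abs]
      refine pow_le_pow_left₀ (abs_nonneg _) ?_ 2
      rw [abs_of_nonneg (le_max_right y 0)]
      exact max_le (le_abs_self y) (abs_nonneg y)
    have h' := h.hasDerivAt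
    simpa using h'
  · have h : HasDerivAt (fun y : ℝ => y ^ 2) (2 * x) x := by simpa using hasDerivAt_pow 2 x
    rw [max_eq_left hx.le]
    refine h.congr_of_eventuallyEq ?_
    filter_upwards [lt_mem_nhds hx] with y hy
    rw [max_eq_left (le_of_lt hy)]

/-- A continuously differentiable bump supported in `[0, 1]` and odd about `1 / 2`. -/
noncomputable def bump (u : ℝ) : ℝ := max u 0 ^ 2 * max (1 - u) 0 ^ 2 * (1 - 2 * u)

/-- The derivative of `bump`. -/
noncomputable def bumpDeriv (u : ℝ) : ℝ :=
  2 * (max u 0 * max (1 - u) 0) * (1 - 5 * (max u 0 * max (1 - u) 0))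

theorem max_mul_max_eq_zero {u : ℝ} (hu : u ∉ Set.Ioo (0 : ℝ) 1) :
    max u 0 * max (1 - u) 0 = 0 := by
  by_cases h : 0 < u
  · have h1 : 1 ≤ u := by
      by_contra! hc
      exact hu ⟨h, hc⟩
    rw [max_eq_right (by linarith : 1 - u ≤ 0), mul_zero]
  · rw [max_eq_right (not_lt.1 h), zero_mul]

theorem max_mul_max_mem (u : ℝ) :
    0 ≤ max u 0 * max (1 - u) 0 ∧ max u 0 * max (1 - u) 0 ≤ 1 / 4 := by
  refine ⟨by positivity, ?_⟩
  by_cases hu : u ∈ Set.Ioo (0 : ℝ) 1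
  · rw [max_eq_left hu.1.le, max_eq_left (by linarith [hu.2])]
    nlinarith [sq_nonneg (u - 1 / 2)]
  · rw [max_mul_max_eq_zero hu]
    norm_num

theorem bump_eq_zero {u : ℝ} (hu : u ∉ Set.Ioo (0 : ℝ) 1) : bump u = 0 := by
  rw [bump, ← mul_pow, max_mul_max_eq_zero hu]
  ring

theorem bumpDeriv_eq_zero {u : ℝ} (hu : u ∉ Set.Ioo (0 : ℝ) 1) : bumpDeriv u = 0 := by
  rw [bumpDeriv, max_mul_max_eq_zero hu]
  ring

theorem bump_one_sub (u : ℝ) : bump (1 - u) = -bump u := by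
  simp only [bump, sub_sub_cancel]
  ring

theorem continuous_bump : Continuous bump := by
  unfold bump
  fun_prop

theorem continuous_bumpDeriv : Continuous bumpDeriv := by
  unfold bumpDeriv
  fun_prop

/-- On the unit interval put s = u(1 - u). The bump is s²s', and s'² = 1 - 4s with s'' = -2 gives
the derivative 2s(1 - 5s). -/
theorem hasDerivAt_bump (u : ℝ) : HasDerivAt bump (bumpDeriv u) u := by
  have h1 := hasDerivAt_max_zero_sq u
  have h2 : HasDerivAt (fun y : ℝ => max (1 - y) 0 ^ 2) (2 * max (1 - u) 0 * (-1)) u :=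
    (hasDerivAt_max_zero_sq (1 - u)).comp u ((hasDerivAt_id u).const_sub 1)
  have h3 : HasDerivAt (fun y : ℝ => 1 - 2 * y) (-(2 * 1)) u :=
    ((hasDerivAt_id u).const_mul 2).const_sub 1
  refine ((h1.mul h2).mul h3).congr_deriv ?_
  by_cases hu : u ∈ Set.Ioo (0 : ℝ) 1
  · rw [bumpDeriv, max_eq_left hu.1.le, max_eq_left (by linarith [hu.2] : (0 : ℝ) ≤ 1 - u)]
    simp only [Pi.mul_apply]
    rw [max_eq_left hu.1.le, max_eq_left (by linarith [hu.2] : (0 : ℝ) ≤ 1 - u)]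
    ring
  · rw [bumpDeriv_eq_zero hu]
    simp only [Pi.mul_apply]
    have h := max_mul_max_eq_zero hu
    linear_combination (2 * (max (1 - u) 0 - max u 0) * (1 - 2 * u) -
      2 * (max u 0 * max (1 - u) 0)) * h

theorem abs_bump_le (u : ℝ) : |bump u| ≤ 1 / 16 := by
  by_cases hu : u ∈ Set.Ioo (0 : ℝ) 1
  · obtain ⟨h0, h1⟩ := max_mul_max_mem u
    rw [bump, ← mul_pow, abs_mul, abs_of_nonneg (by positivity)]
    have h2 : |1 - 2 * u| ≤ 1 := abs_le.2 ⟨by linarith [hu.2], by linarith [hu.1]⟩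
    calc _ ≤ (1 / 4 : ℝ) ^ 2 * 1 := by gcongr
      _ = 1 / 16 := by norm_num
  · rw [bump_eq_zero hu]
    norm_num

/-- For s in [0, 1/4], 2s(1 - 5s) has its maximum 1/10 at s = 1/10 and its minimum -1/8 at s = 1/4.
-/
theorem abs_bumpDeriv_le (u : ℝ) : |bumpDeriv u| ≤ 1 / 8 := by
  obtain ⟨h0, h1⟩ := max_mul_max_mem u
  rw [bumpDeriv, abs_le]
  constructor <;> nlinarith [sq_nonneg (max u 0 * max (1 - u) 0 - 1 / 10)]

/-- The clipped product s is 1-Lipschitz and 2s - 10s² has slope in [-3, 2] on [0, 1/4]. A Lipschitz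
derivative is what the case β = 2 needs. -/
theorem abs_bumpDeriv_sub_le (u v : ℝ) : |bumpDeriv u - bumpDeriv v| ≤ 3 * |u - v| := by
  have hlip : ∀ a b : ℝ, |max a 0 * max (1 - a) 0 - max b 0 * max (1 - b) 0| ≤ |a - b| := by
    have key : ∀ a b : ℝ, a ≤ b →
        |max a 0 * max (1 - a) 0 - max b 0 * max (1 - b) 0| ≤ b - a := by
      intro a b hab
      rw [abs_le]
      rcases le_total a 0 with ha | ha <;> rcases le_total b 0 with hb | hb <;>
      rcases le_total (1 - a) 0 with ha' | ha' <;> rcases le_total (1 - b) 0 with hb' | hb' <;>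
      simp only [max_eq_left, max_eq_right, ha, hb, ha', hb'] <;>
      constructor <;> nlinarith
    intro a b
    rcases le_total a b with h | h
    · rw [abs_sub_comm a b, abs_of_nonneg (sub_nonneg.2 h)]
      exact key a b h
    · rw [abs_sub_comm, abs_of_nonneg (sub_nonneg.2 h)]
      exact key b a h
  obtain ⟨h0, h1⟩ := max_mul_max_mem u
  obtain ⟨h2, h3⟩ := max_mul_max_mem v
  have h := hlip u v
  unfold bumpDeriv
  set s := max u 0 * max (1 - u) 0
  set t := max v 0 * max (1 - v) 0
  have e : 2 * s * (1 - 5 * s) - 2 * t * (1 - 5 * t) = (2 - 10 * (s + t)) * (s - t) := by ring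
  rw [e, abs_mul]
  have h4 : |2 - 10 * (s + t)| ≤ 3 := abs_le.2 ⟨by linarith, by linarith⟩
  gcongr

theorem lintegral_bumpDeriv_sq :
    ∫⁻ u in Set.Ioo (0 : ℝ) 1, ENNReal.ofReal (bumpDeriv u ^ 2) = ENNReal.ofReal (2 / 315) := by
  rw [← ofReal_integral_eq_lintegral_ofReal]
  · congr 1
    rw [← integral_Ioc_eq_integral_Ioo, ← intervalIntegral.integral_of_le zero_le_one]
    have : ∫ u in (0 : ℝ)..1, bumpDeriv u ^ 2 =
        ∫ u in (0 : ℝ)..1, (4 * u ^ 2 - 48 * u ^ 3 + 224 * u ^ 4 - 520 * u ^ 5 + 640 * u ^ 6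
          - 400 * u ^ 7 + 100 * u ^ 8) := by
      refine intervalIntegral.integral_congr fun u hu => ?_
      rw [Set.uIcc_of_le zero_le_one] at hu
      simp only [bumpDeriv, max_eq_left hu.1, max_eq_left (by linarith [hu.2] : (0 : ℝ) ≤ 1 - u)]
      ring
    rw [this]
    have hd : ∀ u ∈ Set.uIcc (0 : ℝ) 1, HasDerivAt (fun u : ℝ => 4 / 3 * u ^ 3 - 12 * u ^ 4 +
        224 / 5 * u ^ 5 - 260 / 3 * u ^ 6 + 640 / 7 * u ^ 7 - 50 * u ^ 8 + 100 / 9 * u ^ 9)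
        (4 * u ^ 2 - 48 * u ^ 3 + 224 * u ^ 4 - 520 * u ^ 5 + 640 * u ^ 6
          - 400 * u ^ 7 + 100 * u ^ 8) u := by
      intro u _
      have hp := fun k : ℕ => hasDerivAt_pow k u
      refine (((((((hp 3).const_mul (4 / 3)).sub ((hp 4).const_mul 12)).add
        ((hp 5).const_mul (224 / 5))).sub ((hp 6).const_mul (260 / 3))).add
        ((hp 7).const_mul (640 / 7))).sub ((hp 8).const_mul 50)).add
        ((hp 9).const_mul (100 / 9)) |>.congr_deriv ?_
      norm_num
      ring
    rw [intervalIntegral.integral_eq_sub_of_hasDerivAt hd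
      (Continuous.intervalIntegrable (by fun_prop) _ _)]
    norm_num
  · exact ((continuous_bumpDeriv.pow 2).integrableOn_Icc (a := 0) (b := 1)).mono_set
      Set.Ioo_subset_Icc_self
  · exact Filter.Eventually.of_forall fun u => sq_nonneg _

/-- The sum of signed translates of `φ` by `0, 1, …, m - 1`. -/
noncomputable def signSum {m : ℕ} (φ : ℝ → ℝ) (θ : Fin m → Bool) (u : ℝ) : ℝ :=
  ∑ j, (bif θ j then 1 else -1) * φ (u - j)

section signSum

variable {m : ℕ} {φ : ℝ → ℝ}

theorem sub_mem_Ioo_iff (u j : ℝ) : u - j ∈ Set.Ioo (0 : ℝ) 1 ↔ u ∈ Set.Ioo j (j + 1) := by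
  simp only [Set.mem_Ioo]
  constructor <;> rintro ⟨h, h'⟩ <;> constructor <;> linarith

theorem eq_of_mem_Ioo_of_mem_Ioo {u : ℝ} {i j : Fin m} (hi : u - (i : ℝ) ∈ Set.Ioo (0 : ℝ) 1)
    (hj : u - (j : ℝ) ∈ Set.Ioo (0 : ℝ) 1) : i = j := by
  have h1 : ((i : ℕ) : ℝ) < (j : ℕ) + 1 := by linarith [hi.1, hj.2]
  have h2 : ((j : ℕ) : ℝ) < (i : ℕ) + 1 := by linarith [hi.2, hj.1]
  have h3 : (i : ℕ) < j + 1 := by exact_mod_cast h1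
  have h4 : (j : ℕ) < i + 1 := by exact_mod_cast h2
  exact Fin.ext (by omega)

theorem signSum_eq_of_mem (hφ : ∀ u ∉ Set.Ioo (0 : ℝ) 1, φ u = 0) (θ : Fin m → Bool) {u : ℝ}
    {j : Fin m} (hu : u - (j : ℝ) ∈ Set.Ioo (0 : ℝ) 1) :
    signSum φ θ u = (bif θ j then 1 else -1) * φ (u - j) := by
  refine Finset.sum_eq_single j (fun i _ hi => ?_) (by simp)
  rw [hφ _ fun h => hi (eq_of_mem_Ioo_of_mem_Ioo h hu), mul_zero]

theorem signSum_eq_zero (hφ : ∀ u ∉ Set.Ioo (0 : ℝ) 1, φ u = 0) (θ : Fin m → Bool) {u : ℝ}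
    (hu : ∀ j : Fin m, u - (j : ℝ) ∉ Set.Ioo (0 : ℝ) 1) : signSum φ θ u = 0 :=
  Finset.sum_eq_zero fun j _ => by rw [hφ _ (hu j), mul_zero]

theorem abs_bif_one_neg_one (b : Bool) : |(bif b then (1 : ℝ) else -1)| = 1 := by
  cases b <;> simp

theorem abs_signSum_le (hφ : ∀ u ∉ Set.Ioo (0 : ℝ) 1, φ u = 0) {C : ℝ} (hC : ∀ u, |φ u| ≤ C)
    (θ : Fin m → Bool) (u : ℝ) : |signSum φ θ u| ≤ C := by
  by_cases h : ∃ j : Fin m, u - (j : ℝ) ∈ Set.Ioo (0 : ℝ) 1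
  · obtain ⟨j, hj⟩ := h
    rw [signSum_eq_of_mem hφ θ hj, abs_mul, abs_bif_one_neg_one, one_mul]
    exact hC _
  · push Not at h
    rw [signSum_eq_zero hφ θ h, abs_zero]
    exact (abs_nonneg _).trans (hC 0)

/-- Only the translates whose supports contain `u` or `v` contribute, and there are at most two of
them; hence the factor 2. -/
theorem abs_signSum_sub_le (hφ : ∀ u ∉ Set.Ioo (0 : ℝ) 1, φ u = 0) {K : ℝ} (hK : 0 ≤ K)
    (hL : ∀ u v, |φ u - φ v| ≤ K * |u - v|) (θ : Fin m → Bool) (u v : ℝ) :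
    |signSum φ θ u - signSum φ θ v| ≤ 2 * K * |u - v| := by
  classical
  have hone : ∀ u : ℝ, ∑ j : Fin m, (if u - (j : ℝ) ∈ Set.Ioo (0 : ℝ) 1 then (1 : ℝ) else 0) ≤ 1 := by
    intro u
    rw [Finset.sum_boole]
    have : (Finset.univ.filter fun j : Fin m => u - (j : ℝ) ∈ Set.Ioo (0 : ℝ) 1).card ≤ 1 := by
      refine Finset.card_le_one.2 fun i hi j hj => ?_
      rw [Finset.mem_filter] at hi hj
      exact eq_of_mem_Ioo_of_mem_Ioo hi.2 hj.2
    exact_mod_cast this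
  have hterm : ∀ j : Fin m, |φ (u - j) - φ (v - j)| ≤ K * |u - v| *
      ((if u - (j : ℝ) ∈ Set.Ioo (0 : ℝ) 1 then (1 : ℝ) else 0) +
        (if v - (j : ℝ) ∈ Set.Ioo (0 : ℝ) 1 then (1 : ℝ) else 0)) := by
    intro j
    have h := hL (u - j) (v - j)
    rw [sub_sub_sub_cancel_right] at h
    have h0 : 0 ≤ K * |u - v| := by positivity
    by_cases hu : u - (j : ℝ) ∈ Set.Ioo (0 : ℝ) 1 <;>
      by_cases hv : v - (j : ℝ) ∈ Set.Ioo (0 : ℝ) 1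
    · rw [if_pos hu, if_pos hv]
      linarith
    · rw [if_pos hu, if_neg hv]
      linarith
    · rw [if_neg hu, if_pos hv]
      linarith
    · rw [if_neg hu, if_neg hv, hφ _ hu, hφ _ hv]
      simp
  have e : signSum φ θ u - signSum φ θ v =
      ∑ j, (bif θ j then 1 else -1) * (φ (u - j) - φ (v - j)) := by
    simp only [signSum, ← Finset.sum_sub_distrib, mul_sub]
  rw [e]
  refine (Finset.abs_sum_le_sum_abs _ _).trans ?_
  calc _ ≤ ∑ j : Fin m, K * |u - v| *
      ((if u - (j : ℝ) ∈ Set.Ioo (0 : ℝ) 1 then (1 : ℝ) else 0) +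
        (if v - (j : ℝ) ∈ Set.Ioo (0 : ℝ) 1 then (1 : ℝ) else 0)) := by
        refine Finset.sum_le_sum fun j _ => ?_
        rw [abs_mul, abs_bif_one_neg_one, one_mul]
        exact hterm j
    _ ≤ K * |u - v| * (1 + 1) := by
        rw [← Finset.mul_sum, Finset.sum_add_distrib]
        have h0 : 0 ≤ K * |u - v| := by positivity
        exact mul_le_mul_of_nonneg_left (add_le_add (hone u) (hone v)) h0
    _ = _ := by ring

theorem continuous_signSum (hφ : Continuous φ) (θ : Fin m → Bool) : Continuous (signSum φ θ) := by
  unfold signSum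
  fun_prop

theorem hasDerivAt_signSum_bump (θ : Fin m → Bool) (u : ℝ) :
    HasDerivAt (signSum bump θ) (signSum bumpDeriv θ u) u := by
  unfold signSum
  refine HasDerivAt.fun_sum fun j _ => HasDerivAt.const_mul _ ?_
  exact (hasDerivAt_bump (u - j)).comp_sub_const u (j : ℝ)

end signSum
-- The base density: a plateau with Cauchy tails
/-- The signed distance from `x` to the interval `[0, ℓ]`. -/
noncomputable def tailPart (ℓ x : ℝ) : ℝ := max (x - ℓ) 0 - max (-x) 0

theorem tailPart_eq_zero {ℓ x : ℝ} (hx : x ∈ Set.Icc 0 ℓ) : tailPart ℓ x = 0 := by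
  rw [tailPart, max_eq_right (by linarith [hx.2]), max_eq_right (by linarith [hx.1]), sub_zero]

theorem tailPart_sq {ℓ : ℝ} (hℓ : 0 ≤ ℓ) (x : ℝ) :
    tailPart ℓ x ^ 2 = max (x - ℓ) 0 ^ 2 + max (-x) 0 ^ 2 := by
  have h : max (x - ℓ) 0 * max (-x) 0 = 0 := by
    rcases le_total 0 x with hx | hx
    · rw [max_eq_right (by linarith : -x ≤ 0), mul_zero]
    · rw [max_eq_right (by linarith : x - ℓ ≤ 0), zero_mul]
  rw [tailPart]
  linear_combination (-2) * h

theorem continuous_tailPart (ℓ : ℝ) : Continuous (tailPart ℓ) := by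
  unfold tailPart
  fun_prop

theorem abs_tailPart_sub_le {ℓ : ℝ} (hℓ : 0 ≤ ℓ) (x y : ℝ) :
    |tailPart ℓ x - tailPart ℓ y| ≤ |x - y| := by
  have key : ∀ x y : ℝ, x ≤ y → |tailPart ℓ x - tailPart ℓ y| ≤ y - x := by
    intro x y hxy
    unfold tailPart
    rw [abs_le]
    rcases le_total (x - ℓ) 0 with h1 | h1 <;> rcases le_total (y - ℓ) 0 with h2 | h2 <;>
    rcases le_total (-x) 0 with h3 | h3 <;> rcases le_total (-y) 0 with h4 | h4 <;>
    simp only [max_eq_left, max_eq_right, h1, h2, h3, h4] <;>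
    constructor <;> linarith
  rcases le_total x y with h | h
  · rw [abs_sub_comm x y, abs_of_nonneg (sub_nonneg.2 h)]
    exact key x y h
  · rw [abs_sub_comm, abs_of_nonneg (sub_nonneg.2 h)]
    exact key y x h

theorem hasDerivAt_tailPart_sq {ℓ : ℝ} (hℓ : 0 ≤ ℓ) (x : ℝ) :
    HasDerivAt (fun y => tailPart ℓ y ^ 2) (2 * tailPart ℓ x) x := by
  have e : (fun y => tailPart ℓ y ^ 2) = fun y => max (y - ℓ) 0 ^ 2 + max (-y) 0 ^ 2 :=
    funext fun y => tailPart_sq hℓ y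
  rw [e]
  have h1 := (hasDerivAt_max_zero_sq (x - ℓ)).comp_sub_const x ℓ
  have h2 : HasDerivAt (fun y : ℝ => max (-y) 0 ^ 2) (2 * max (-x) 0 * (-1)) x :=
    (hasDerivAt_max_zero_sq (-x)).comp x (hasDerivAt_neg x)
  refine (h1.add h2).congr_deriv ?_
  rw [tailPart]
  ring

/-- An unnormalised density that is constant on `[0, ℓ]` and has Cauchy tails. -/
noncomputable def baseFun (a ℓ x : ℝ) : ℝ := (1 + a ^ 2 * tailPart ℓ x ^ 2)⁻¹

/-- The score of `baseFun` as a function of the signed distance to `[0, ℓ]`. -/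
noncomputable def baseScore (a t : ℝ) : ℝ := -(2 * a ^ 2 * t / (1 + a ^ 2 * t ^ 2))

theorem baseFun_pos (a ℓ x : ℝ) : 0 < baseFun a ℓ x := by
  unfold baseFun
  positivity

theorem baseFun_le_one (a ℓ x : ℝ) : baseFun a ℓ x ≤ 1 := by
  unfold baseFun
  apply inv_le_one_of_one_le₀
  nlinarith [mul_nonneg (sq_nonneg a) (sq_nonneg (tailPart ℓ x))]

theorem baseFun_eq_one (a : ℝ) {ℓ x : ℝ} (hx : x ∈ Set.Icc 0 ℓ) : baseFun a ℓ x = 1 := by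
  rw [baseFun, tailPart_eq_zero hx]
  simp

theorem continuous_baseFun (a ℓ : ℝ) : Continuous (baseFun a ℓ) := by
  unfold baseFun
  have := continuous_tailPart ℓ
  refine Continuous.inv₀ (by fun_prop) fun x => ?_
  positivity

theorem hasDerivAt_log_baseFun (a : ℝ) {ℓ : ℝ} (hℓ : 0 ≤ ℓ) (x : ℝ) :
    HasDerivAt (fun y => Real.log (baseFun a ℓ y)) (baseScore a (tailPart ℓ x)) x := by
  have e : (fun y => Real.log (baseFun a ℓ y)) =
      fun y => -Real.log (1 + a ^ 2 * tailPart ℓ y ^ 2) :=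
    funext fun y => by rw [baseFun, Real.log_inv]
  rw [e]
  have h0 : 1 + a ^ 2 * tailPart ℓ x ^ 2 ≠ 0 := by positivity
  refine ((((hasDerivAt_tailPart_sq hℓ x).const_mul (a ^ 2)).const_add 1).log h0).neg.congr_deriv ?_
  rw [baseScore]
  ring

theorem abs_baseScore_le {a : ℝ} (ha : 0 ≤ a) (t : ℝ) : |baseScore a t| ≤ a := by
  have h : 0 < 1 + a ^ 2 * t ^ 2 := by positivity
  rw [baseScore, abs_neg, abs_div, abs_of_pos h, div_le_iff₀ h, abs_le]
  constructor <;> nlinarith [mul_nonneg ha (sq_nonneg (a * t - 1)),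
    mul_nonneg ha (sq_nonneg (a * t + 1))]

/-- The difference quotient factors as 2a² times a ratio whose numerator a²st - 1 is dominated by
the product of the two denominators. -/
theorem abs_baseScore_sub_le (a s t : ℝ) :
    |baseScore a s - baseScore a t| ≤ 2 * a ^ 2 * |s - t| := by
  have hs : 0 < 1 + a ^ 2 * s ^ 2 := by positivity
  have ht : 0 < 1 + a ^ 2 * t ^ 2 := by positivity
  have e : baseScore a s - baseScore a t = 2 * a ^ 2 * (s - t) *
      ((a ^ 2 * s * t - 1) / ((1 + a ^ 2 * s ^ 2) * (1 + a ^ 2 * t ^ 2))) := by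
    unfold baseScore
    field_simp
    ring
  have h : |(a ^ 2 * s * t - 1) / ((1 + a ^ 2 * s ^ 2) * (1 + a ^ 2 * t ^ 2))| ≤ 1 := by
    rw [abs_div, abs_of_pos (mul_pos hs ht), div_le_one (mul_pos hs ht), abs_le]
    have h1 : 0 ≤ (a * s) ^ 2 * (a * t) ^ 2 := by positivity
    constructor <;> nlinarith [sq_nonneg (a * s - a * t), sq_nonneg (a * s + a * t)]
  rw [e, abs_mul, abs_mul, abs_of_nonneg (by positivity : 0 ≤ 2 * a ^ 2)]
  exact mul_le_of_le_one_right (by positivity) h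

theorem lintegral_inv_one_add_mul_sq {a : ℝ} (ha : 0 < a) (ℓ : ℝ) :
    ∫⁻ x, ENNReal.ofReal (1 + (a * (x - ℓ)) ^ 2)⁻¹ = ENNReal.ofReal (Real.pi / a) := by
  have hi : Integrable fun x : ℝ => (1 + (a * (x - ℓ)) ^ 2)⁻¹ :=
    (integrable_inv_one_add_sq.comp_mul_left' ha.ne').comp_sub_right ℓ
  rw [← ofReal_integral_eq_lintegral_ofReal hi (Filter.Eventually.of_forall fun x => by positivity)]
  rw [integral_sub_right_eq_self (fun x : ℝ => (1 + (a * x) ^ 2)⁻¹) ℓ,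
    Measure.integral_comp_mul_left (fun x : ℝ => (1 + x ^ 2)⁻¹) a, integral_univ_inv_one_add_sq,
    abs_of_pos (inv_pos.2 ha), smul_eq_mul, div_eq_inv_mul]

theorem le_lintegral_baseFun {a ℓ : ℝ} (ha : 0 < a) (hℓ : 0 ≤ ℓ) :
    ENNReal.ofReal (Real.pi / a) ≤ ∫⁻ x, ENNReal.ofReal (baseFun a ℓ x) := by
  rw [← lintegral_inv_one_add_mul_sq ha 0]
  refine lintegral_mono fun x => ENNReal.ofReal_le_ofReal ?_
  unfold baseFun
  have h : |tailPart ℓ x| ≤ |x - 0| := by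
    simpa [tailPart_eq_zero (⟨le_rfl, hℓ⟩ : (0 : ℝ) ∈ Set.Icc 0 ℓ)] using
      abs_tailPart_sub_le hℓ x 0
  rw [mul_pow]
  gcongr ?_⁻¹
  have := sq_le_sq.2 h
  gcongr

/-- The plateau contributes `ℓ`, and each tail is bounded by a whole Cauchy integral. -/
theorem lintegral_baseFun_le {a ℓ : ℝ} (ha : 0 < a) (hℓ : 0 ≤ ℓ) :
    ∫⁻ x, ENNReal.ofReal (baseFun a ℓ x) ≤ ENNReal.ofReal (ℓ + 2 * (Real.pi / a)) := by
  have hpi := Real.pi_pos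
  have h1 : Measurable fun x : ℝ => ENNReal.ofReal (1 + (a * (x - 0)) ^ 2)⁻¹ := by fun_prop
  have h2 : Measurable fun x : ℝ => ENNReal.ofReal (1 + (a * (x - ℓ)) ^ 2)⁻¹ := by fun_prop
  have h3 : ∫⁻ x, (Set.Icc 0 ℓ).indicator (fun _ => (1 : ℝ≥0∞)) x = ENNReal.ofReal ℓ := by
    rw [lintegral_indicator measurableSet_Icc, setLIntegral_const, one_mul, Real.volume_Icc,
      sub_zero]
  have hpt : ∀ x, ENNReal.ofReal (baseFun a ℓ x) ≤ (Set.Icc 0 ℓ).indicator (fun _ => 1) x +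
      (ENNReal.ofReal (1 + (a * (x - 0)) ^ 2)⁻¹ + ENNReal.ofReal (1 + (a * (x - ℓ)) ^ 2)⁻¹) := by
    intro x
    by_cases hx : x ∈ Set.Icc 0 ℓ
    · rw [Set.indicator_of_mem hx, baseFun_eq_one a hx, ENNReal.ofReal_one]
      exact le_self_add
    · rw [Set.indicator_of_notMem hx, zero_add]
      rw [Set.mem_Icc, not_and_or, not_le, not_le] at hx
      rcases hx with hx | hx
      · refine le_trans (le_of_eq ?_) le_self_add
        rw [baseFun, tailPart, max_eq_right (by linarith), max_eq_left (by linarith)]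
        congr 2
        ring
      · refine le_trans (le_of_eq ?_) le_add_self
        rw [baseFun, tailPart, max_eq_left (by linarith), max_eq_right (by linarith)]
        congr 2
        ring
  refine (lintegral_mono hpt).trans_eq ?_
  rw [lintegral_add_left (measurable_const.indicator measurableSet_Icc), h3,
    lintegral_add_left h1, lintegral_inv_one_add_mul_sq ha, lintegral_inv_one_add_mul_sq ha,
    two_mul, ENNReal.ofReal_add hℓ (by positivity), ENNReal.ofReal_add (by positivity) (by positivity)]

/-! ### Bins of equal width -/

/-- The `j`th interval of length `w`. -/
def bin (w : ℝ) (j : ℕ) : Set ℝ := Set.Ioo (j * w) ((j + 1) * w)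

theorem mem_bin {w : ℝ} (hw : 0 < w) {j : ℕ} {x : ℝ} :
    x ∈ bin w j ↔ x / w - j ∈ Set.Ioo (0 : ℝ) 1 := by
  rw [sub_mem_Ioo_iff, bin, Set.mem_Ioo, Set.mem_Ioo, lt_div_iff₀ hw, div_lt_iff₀ hw]

theorem measurableSet_bin (w : ℝ) (j : ℕ) : MeasurableSet (bin w j) := measurableSet_Ioo

theorem volume_bin (w : ℝ) (j : ℕ) : volume (bin w j) = ENNReal.ofReal w := by
  rw [bin, Real.volume_Ioo]
  congr 1
  ring

theorem bin_subset_Icc {w : ℝ} (hw : 0 < w) {m : ℕ} (j : Fin m) :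
    bin w j ⊆ Set.Icc 0 (m * w) := by
  intro x hx
  have h1 : (0 : ℝ) ≤ (j : ℕ) * w := by positivity
  have h2 : ((j : ℕ) + 1 : ℝ) ≤ m := by exact_mod_cast j.2
  have h3 : ((j : ℕ) + 1 : ℝ) * w ≤ m * w := by gcongr
  exact ⟨h1.trans hx.1.le, hx.2.le.trans h3⟩

theorem pairwise_disjoint_bin {w : ℝ} (hw : 0 < w) (m : ℕ) :
    Pairwise (Function.onFun Disjoint fun j : Fin m => bin w j) := by
  intro i j hij
  refine Set.disjoint_left.2 fun x hi hj => hij ?_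
  rw [mem_bin hw] at hi hj
  exact eq_of_mem_Ioo_of_mem_Ioo hi hj

theorem volume_iUnion_bin {w : ℝ} (hw : 0 < w) (m : ℕ) :
    volume (⋃ j : Fin m, bin w j) = ENNReal.ofReal (m * w) := by
  rw [measure_iUnion (pairwise_disjoint_bin hw m) fun j => measurableSet_bin w j]
  simp only [volume_bin, tsum_fintype, Finset.sum_const, Finset.card_univ, Fintype.card_fin,
    nsmul_eq_mul]
  rw [ENNReal.ofReal_mul (by positivity), ENNReal.ofReal_natCast]

theorem signSum_div_eq_of_mem_bin {w : ℝ} (hw : 0 < w) {m : ℕ} {φ : ℝ → ℝ}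
    (hφ : ∀ u ∉ Set.Ioo (0 : ℝ) 1, φ u = 0) (θ : Fin m → Bool) {j : Fin m} {x : ℝ}
    (hx : x ∈ bin w j) :
    signSum φ θ (x / w) = (bif θ j then 1 else -1) * φ (x / w - (j : ℕ)) :=
  signSum_eq_of_mem hφ θ ((mem_bin hw).1 hx)

theorem signSum_div_eq_zero {w : ℝ} (hw : 0 < w) {m : ℕ} {φ : ℝ → ℝ}
    (hφ : ∀ u ∉ Set.Ioo (0 : ℝ) 1, φ u = 0) (θ : Fin m → Bool) {x : ℝ}
    (hx : x ∉ ⋃ j : Fin m, bin w j) : signSum φ θ (x / w) = 0 :=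
  signSum_eq_zero hφ θ fun j hj => hx (Set.mem_iUnion.2 ⟨j, (mem_bin hw).2 hj⟩)

theorem setLIntegral_bin_comp {w : ℝ} (hw : 0 < w) (j : ℕ) (F : ℝ → ℝ≥0∞) :
    ∫⁻ x in bin w j, F (x / w - j) = ENNReal.ofReal w * ∫⁻ u in Set.Ioo (0 : ℝ) 1, F u := by
  rw [← lintegral_indicator (measurableSet_bin w j), ← lintegral_indicator measurableSet_Ioo]
  have e : ∀ x, (bin w j).indicator (fun x => F (x / w - j)) x =
      (Set.Ioo (0 : ℝ) 1).indicator F (w⁻¹ * x - j) := by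
    intro x
    rw [inv_mul_eq_div]
    by_cases hx : x ∈ bin w j
    · rw [Set.indicator_of_mem hx, Set.indicator_of_mem ((mem_bin hw).1 hx)]
    · rw [Set.indicator_of_notMem hx, Set.indicator_of_notMem (mt (mem_bin hw).2 hx)]
  simp_rw [e]
  rw [← (measurableEmbedding_mulLeft₀ (inv_ne_zero hw.ne')).lintegral_map
    fun y => (Set.Ioo (0 : ℝ) 1).indicator F (y - j),
    Real.map_volume_mul_left (inv_ne_zero hw.ne'), lintegral_smul_measure, inv_inv, abs_of_pos hw,
    lintegral_sub_right_eq_self (fun y => (Set.Ioo (0 : ℝ) 1).indicator F y) (j : ℝ), smul_eq_mul]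

/-- Reflection in 1/2 preserves the interval and changes the sign of the bump. -/
theorem lintegral_comp_neg_bump (G : ℝ → ℝ≥0∞) :
    ∫⁻ u in Set.Ioo (0 : ℝ) 1, G (-bump u) = ∫⁻ u in Set.Ioo (0 : ℝ) 1, G (bump u) := by
  rw [← lintegral_indicator measurableSet_Ioo, ← lintegral_indicator measurableSet_Ioo,
    ← lintegral_sub_left_eq_self _ (1 : ℝ)]
  refine lintegral_congr fun u => ?_
  have : 1 - u ∈ Set.Ioo (0 : ℝ) 1 ↔ u ∈ Set.Ioo (0 : ℝ) 1 := by
    simp only [Set.mem_Ioo]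
    constructor <;> rintro ⟨h, h'⟩ <;> constructor <;> linarith
  by_cases hu : u ∈ Set.Ioo (0 : ℝ) 1
  · rw [Set.indicator_of_mem hu, Set.indicator_of_mem (this.2 hu), bump_one_sub, neg_neg]
  · rw [Set.indicator_of_notMem hu, Set.indicator_of_notMem (mt this.1 hu)]
-- Tilted densities and their membership in the class
/-- The base function, tilted by signed bumps of height `A` on the bins of `[0, m w]`. -/
noncomputable def tiltedFun (a w A : ℝ) {m : ℕ} (θ : Fin m → Bool) (x : ℝ) : ℝ :=
  baseFun a (m * w) x * Real.exp (A * signSum bump θ (x / w))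

/-- The total mass of `tiltedFun`; it does not depend on the signs. -/
noncomputable def tiltedMass (a w A : ℝ) (m : ℕ) : ℝ :=
  (∫⁻ x, ENNReal.ofReal (tiltedFun a w A (fun _ : Fin m => true) x)).toReal

/-- The probability density proportional to `tiltedFun`. -/
noncomputable def tiltedDensity (a w A : ℝ) {m : ℕ} (θ : Fin m → Bool) (x : ℝ) : ℝ :=
  tiltedFun a w A θ x / tiltedMass a w A m

section tilted

variable {a w A : ℝ} {m : ℕ}

theorem abs_mul_signSum_bump_le (hA : 0 < A) (θ : Fin m → Bool) (u : ℝ) :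
    |A * signSum bump θ u| ≤ A / 16 := by
  have h := abs_signSum_le (fun u => bump_eq_zero) abs_bump_le θ u
  rw [abs_mul, abs_of_pos hA]
  calc _ ≤ A * (1 / 16) := by gcongr
    _ = _ := by ring

theorem exp_mul_signSum_mem (hA : 0 < A) (hA' : A ≤ 1) (θ : Fin m → Bool) (u : ℝ) :
    1 / 2 ≤ Real.exp (A * signSum bump θ u) ∧ Real.exp (A * signSum bump θ u) ≤ 2 := by
  have h := abs_le.1 (abs_mul_signSum_bump_le hA θ u)
  have h1 := Real.add_one_le_exp (A * signSum bump θ u)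
  have h2 := Real.add_one_le_exp (-(A * signSum bump θ u))
  have h3 : Real.exp (A * signSum bump θ u) * Real.exp (-(A * signSum bump θ u)) = 1 := by
    rw [← Real.exp_add, add_neg_cancel, Real.exp_zero]
  have h4 := Real.exp_pos (A * signSum bump θ u)
  constructor
  · linarith
  · nlinarith

theorem tiltedFun_pos (a w A : ℝ) (θ : Fin m → Bool) (x : ℝ) : 0 < tiltedFun a w A θ x :=
  mul_pos (baseFun_pos _ _ _) (Real.exp_pos _)

theorem continuous_tiltedFun (a w A : ℝ) (θ : Fin m → Bool) : Continuous (tiltedFun a w A θ) := by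
  have h1 := continuous_baseFun a (m * w)
  have h2 := continuous_signSum continuous_bump θ
  unfold tiltedFun
  fun_prop

/-- The base is 1 on every bin, so a bin has mass w∫exp(±A b), which is the same for both signs
because b is odd; off the bins there is no tilt. One normalising constant therefore serves the whole
cube. -/
theorem lintegral_tiltedFun_eq (a A : ℝ) (hw : 0 < w) (θ θ' : Fin m → Bool) :
    ∫⁻ x, ENNReal.ofReal (tiltedFun a w A θ x) = ∫⁻ x, ENNReal.ofReal (tiltedFun a w A θ' x) := by
  have hU : MeasurableSet (⋃ j : Fin m, bin w j) := MeasurableSet.iUnion fun j => measurableSet_bin w j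
  have key : ∀ θ : Fin m → Bool, ∫⁻ x, ENNReal.ofReal (tiltedFun a w A θ x) =
      (∑ _j : Fin m, ENNReal.ofReal w *
        ∫⁻ u in Set.Ioo (0 : ℝ) 1, ENNReal.ofReal (Real.exp (A * bump u))) +
      ∫⁻ x in (⋃ j : Fin m, bin w j)ᶜ, ENNReal.ofReal (baseFun a (m * w) x) := by
    intro θ
    rw [← lintegral_add_compl _ hU]
    congr 1
    · rw [lintegral_iUnion (s := fun j : Fin m => bin w j) (fun j => measurableSet_bin w j) (pairwise_disjoint_bin hw m),
        tsum_fintype]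
      refine Finset.sum_congr rfl fun j _ => ?_
      have e : ∀ x ∈ bin w j, ENNReal.ofReal (tiltedFun a w A θ x) =
          (fun u => ENNReal.ofReal (Real.exp (A * ((bif θ j then 1 else -1) * bump u))))
            (x / w - (j : ℕ)) := by
        intro x hx
        rw [tiltedFun, baseFun_eq_one a (bin_subset_Icc hw j hx),
          signSum_div_eq_of_mem_bin hw (fun u => bump_eq_zero) θ hx, one_mul]
      rw [setLIntegral_congr_fun (measurableSet_bin w j) e, setLIntegral_bin_comp hw j
        fun u => ENNReal.ofReal (Real.exp (A * ((bif θ j then 1 else -1) * bump u)))]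
      congr 1
      cases θ j
      · simp only [cond_false, neg_one_mul]
        exact lintegral_comp_neg_bump fun v => ENNReal.ofReal (Real.exp (A * v))
      · simp only [cond_true, one_mul]
    · refine setLIntegral_congr_fun hU.compl fun x hx => ?_
      simp only [tiltedFun]
      rw [signSum_div_eq_zero hw (fun u => bump_eq_zero) θ hx, mul_zero, Real.exp_zero, mul_one]
  rw [key θ, key θ']

variable (ha : 0 < a) (hw : 0 < w) (hA : 0 < A) (hA' : A ≤ 1)

include ha hw hA hA'

theorem le_lintegral_tiltedFun (θ : Fin m → Bool) :
    ENNReal.ofReal (1 / a) ≤ ∫⁻ x, ENNReal.ofReal (tiltedFun a w A θ x) := by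
  have h := le_lintegral_baseFun ha (by positivity : 0 ≤ m * w)
  have hpi := Real.pi_gt_three
  calc ENNReal.ofReal (1 / a) ≤ ENNReal.ofReal (1 / 2) * ENNReal.ofReal (Real.pi / a) := by
        rw [← ENNReal.ofReal_mul (by norm_num)]
        apply ENNReal.ofReal_le_ofReal
        rw [← mul_div_assoc]
        gcongr
        linarith
    _ ≤ ENNReal.ofReal (1 / 2) * ∫⁻ x, ENNReal.ofReal (baseFun a (m * w) x) := by gcongr
    _ ≤ _ := by
        rw [← lintegral_const_mul' _ _ (by simp)]
        refine lintegral_mono fun x => ?_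
        rw [← ENNReal.ofReal_mul (by norm_num), mul_comm]
        apply ENNReal.ofReal_le_ofReal
        have := (exp_mul_signSum_mem hA hA' θ (x / w)).1
        exact mul_le_mul_of_nonneg_left this (baseFun_pos _ _ _).le

theorem lintegral_tiltedFun_le (haw : a * (m * w) ≤ 1 / 4) (θ : Fin m → Bool) :
    ∫⁻ x, ENNReal.ofReal (tiltedFun a w A θ x) ≤ ENNReal.ofReal (14 / a) := by
  have h := lintegral_baseFun_le ha (by positivity : 0 ≤ m * w)
  have hpi := Real.pi_lt_d2
  have hpi' := Real.pi_pos
  calc _ ≤ ∫⁻ x, ENNReal.ofReal 2 * ENNReal.ofReal (baseFun a (m * w) x) := by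
        refine lintegral_mono fun x => ?_
        rw [← ENNReal.ofReal_mul (by norm_num), mul_comm 2]
        apply ENNReal.ofReal_le_ofReal
        have := (exp_mul_signSum_mem hA hA' θ (x / w)).2
        exact mul_le_mul_of_nonneg_left this (baseFun_pos _ _ _).le
    _ ≤ ENNReal.ofReal 2 * ENNReal.ofReal (m * w + 2 * (Real.pi / a)) := by
        rw [lintegral_const_mul' _ _ (by simp)]
        gcongr
    _ ≤ _ := by
        rw [← ENNReal.ofReal_mul (by norm_num)]
        apply ENNReal.ofReal_le_ofReal
        -- After multiplication by `a` the bound is 2(1/4) + 4π, which is below 14.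
        rw [le_div_iff₀ ha]
        have e : 2 * (m * w + 2 * (Real.pi / a)) * a = 2 * (a * (m * w)) + 4 * Real.pi := by
          field_simp
          ring
        rw [e]
        linarith

theorem ofReal_tiltedMass (haw : a * (m * w) ≤ 1 / 4) (θ : Fin m → Bool) :
    ENNReal.ofReal (tiltedMass a w A m) = ∫⁻ x, ENNReal.ofReal (tiltedFun a w A θ x) := by
  -- Finiteness matters here: `toReal` would send an infinite mass to 0.
  rw [tiltedMass, ENNReal.ofReal_toReal, lintegral_tiltedFun_eq a A hw]
  exact ne_top_of_le_ne_top ENNReal.ofReal_ne_top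
    (lintegral_tiltedFun_le ha hw hA hA' haw fun _ => true)

theorem tiltedMass_bounds (haw : a * (m * w) ≤ 1 / 4) :
    1 / a ≤ tiltedMass a w A m ∧ tiltedMass a w A m ≤ 14 / a := by
  have h := ofReal_tiltedMass ha hw hA hA' haw fun _ : Fin m => true
  constructor
  · rw [← ENNReal.ofReal_le_ofReal_iff (q := tiltedMass a w A m) ENNReal.toReal_nonneg]
    exact (le_lintegral_tiltedFun ha hw hA hA' _).trans_eq h.symm
  · rw [← ENNReal.ofReal_le_ofReal_iff (by positivity), h]
    exact lintegral_tiltedFun_le ha hw hA hA' haw _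

theorem tiltedMass_pos (haw : a * (m * w) ≤ 1 / 4) : 0 < tiltedMass a w A m :=
  (one_div_pos.2 ha).trans_le (tiltedMass_bounds ha hw hA hA' haw).1

theorem tiltedDensity_pos (haw : a * (m * w) ≤ 1 / 4) (θ : Fin m → Bool) (x : ℝ) :
    0 < tiltedDensity a w A θ x :=
  div_pos (tiltedFun_pos _ _ _ _ _) (tiltedMass_pos ha hw hA hA' haw)

theorem isDensity_tiltedDensity (haw : a * (m * w) ≤ 1 / 4) (θ : Fin m → Bool) :
    IsDensity (tiltedDensity a w A θ) := by
  have hZ := tiltedMass_pos ha hw hA hA' haw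
  refine ⟨((continuous_tiltedFun a w A θ).div_const _).measurable,
    fun x => (tiltedDensity_pos ha hw hA hA' haw θ x).le, ?_⟩
  simp only [tiltedDensity, div_eq_inv_mul, ENNReal.ofReal_mul (inv_nonneg.2 hZ.le)]
  rw [lintegral_const_mul' _ _ (by simp), ← ofReal_tiltedMass ha hw hA hA' haw θ,
    ← ENNReal.ofReal_mul (inv_nonneg.2 hZ.le), inv_mul_cancel₀ hZ.ne', ENNReal.ofReal_one]

theorem tiltedDensity_le (haw : a * (m * w) ≤ 1 / 4) (θ : Fin m → Bool) (x : ℝ) :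
    tiltedDensity a w A θ x ≤ 2 * a := by
  have hZ := tiltedMass_pos ha hw hA hA' haw
  have hZ' := (tiltedMass_bounds ha hw hA hA' haw).1
  have h1 : tiltedFun a w A θ x ≤ 1 * 2 :=
    mul_le_mul (baseFun_le_one _ _ _) (exp_mul_signSum_mem hA hA' θ _).2 (Real.exp_pos _).le
      zero_le_one
  rw [tiltedDensity, div_le_iff₀ hZ]
  have : 2 * a * (1 / a) ≤ 2 * a * tiltedMass a w A m := by gcongr
  rw [mul_one_div, mul_div_cancel_right₀ _ ha.ne'] at this
  linarith

theorem le_tiltedDensity (haw : a * (m * w) ≤ 1 / 4) (θ : Fin m → Bool) {x : ℝ}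
    (hx : x ∈ Set.Icc 0 (m * w)) : a / 28 ≤ tiltedDensity a w A θ x := by
  have hZ := tiltedMass_pos ha hw hA hA' haw
  have hZ' := (tiltedMass_bounds ha hw hA hA' haw).2
  rw [tiltedDensity, tiltedFun, baseFun_eq_one a hx, one_mul, le_div_iff₀ hZ]
  have : a / 28 * tiltedMass a w A m ≤ a / 28 * (14 / a) := by gcongr
  have e : a / 28 * (14 / a) = 1 / 2 := by
    field_simp
    norm_num
  rw [e] at this
  exact this.trans (exp_mul_signSum_mem hA hA' θ _).1

theorem hasDerivAt_log_tiltedDensity (haw : a * (m * w) ≤ 1 / 4) (θ : Fin m → Bool) (x : ℝ) :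
    HasDerivAt (fun y => Real.log (tiltedDensity a w A θ y))
      (baseScore a (tailPart (m * w) x) + A / w * signSum bumpDeriv θ (x / w)) x := by
  have hZ := tiltedMass_pos ha hw hA hA' haw
  have e : (fun y => Real.log (tiltedDensity a w A θ y)) = fun y =>
      Real.log (baseFun a (m * w) y) + A * signSum bump θ (y / w) -
        Real.log (tiltedMass a w A m) := by
    funext y
    rw [tiltedDensity, Real.log_div (tiltedFun_pos _ _ _ _ _).ne' hZ.ne', tiltedFun,
      Real.log_mul (baseFun_pos _ _ _).ne' (Real.exp_pos _).ne', Real.log_exp]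
  rw [e]
  have h1 := hasDerivAt_log_baseFun a (by positivity : 0 ≤ m * w) x
  have h2 : HasDerivAt (fun y => signSum bump θ (y / w)) (signSum bumpDeriv θ (x / w) * (1 / w)) x :=
    HasDerivAt.comp x (h₂ := signSum bump θ) (hasDerivAt_signSum_bump θ (x / w))
      ((hasDerivAt_id x).div_const w)
  refine ((h1.add (h2.const_mul A)).sub_const _).congr_deriv ?_
  ring

theorem score_tiltedDensity (haw : a * (m * w) ≤ 1 / 4) (θ : Fin m → Bool) (x : ℝ) :
    score (tiltedDensity a w A θ) x =
      baseScore a (tailPart (m * w) x) + A / w * signSum bumpDeriv θ (x / w) :=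
  (hasDerivAt_log_tiltedDensity ha hw hA hA' haw θ x).deriv

theorem score_tiltedDensity_of_mem (haw : a * (m * w) ≤ 1 / 4) (θ : Fin m → Bool) {x : ℝ}
    (hx : x ∈ Set.Icc 0 (m * w)) :
    score (tiltedDensity a w A θ) x = A / w * signSum bumpDeriv θ (x / w) := by
  rw [score_tiltedDensity ha hw hA hA' haw, tailPart_eq_zero hx, baseScore]
  simp

omit ha hA' in
theorem abs_mul_signSum_bumpDeriv_le (θ : Fin m → Bool) (u : ℝ) :
    |A / w * signSum bumpDeriv θ u| ≤ A / w / 8 := by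
  have h := abs_signSum_le (fun u => bumpDeriv_eq_zero) abs_bumpDeriv_le θ u
  have h0 : 0 < A / w := by positivity
  rw [abs_mul, abs_of_pos h0]
  calc _ ≤ A / w * (1 / 8) := by gcongr
    _ = _ := by ring

theorem locallyAbsCont_tiltedDensity (haw : a * (m * w) ≤ 1 / 4) (θ : Fin m → Bool) :
    LocallyAbsCont (tiltedDensity a w A θ) := by
  have hpos := tiltedDensity_pos ha hw hA hA' haw θ
  have hd : ∀ x, HasDerivAt (tiltedDensity a w A θ) (tiltedDensity a w A θ x *
      (baseScore a (tailPart (m * w) x) + A / w * signSum bumpDeriv θ (x / w))) x := by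
    intro x
    have h := (hasDerivAt_log_tiltedDensity ha hw hA hA' haw θ x).exp
    simp only [Real.exp_log (hpos _)] at h
    exact h
  have hA0 : 0 < A / w := by positivity
  have hb : ∀ x, ‖deriv (tiltedDensity a w A θ) x‖₊ ≤ (2 * a * (a + A / w / 8)).toNNReal := by
    intro x
    rw [← NNReal.coe_le_coe, coe_nnnorm, Real.coe_toNNReal _ (by positivity), (hd x).deriv,
      Real.norm_eq_abs, abs_mul, abs_of_pos (hpos x)]
    refine mul_le_mul (tiltedDensity_le ha hw hA hA' haw θ x) ?_ (abs_nonneg _) (by positivity)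
    exact (abs_add_le _ _).trans (add_le_add (abs_baseScore_le ha.le _)
      (abs_mul_signSum_bumpDeriv_le hw hA θ _))
  have hL := lipschitzWith_of_nnnorm_deriv_le (fun x => (hd x).differentiableAt) hb
  exact fun b c => hL.lipschitzOnWith.absolutelyContinuousOnInterval

/-- Off the plateau the score is at most a in size and the mass at most 1. On it the score is at
most A/(8w), the density at most 2a and the length mw. -/
theorem fisherInfo_tiltedDensity_le (haw : a * (m * w) ≤ 1 / 4) (θ : Fin m → Bool) :
    fisherInfo (tiltedDensity a w A θ) ≤
      ENNReal.ofReal (a ^ 2 + (A / w) ^ 2 * (a * (m * w))) := by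
  have hdens := isDensity_tiltedDensity ha hw hA hA' haw θ
  have hpos := tiltedDensity_pos ha hw hA hA' haw θ
  have hA0 : 0 < A / w := by positivity
  have hpt : ∀ x, ENNReal.ofReal (score (tiltedDensity a w A θ) x ^ 2 * tiltedDensity a w A θ x) ≤
      ENNReal.ofReal (a ^ 2) * ENNReal.ofReal (tiltedDensity a w A θ x) +
        (Set.Icc 0 (m * w)).indicator (fun _ => ENNReal.ofReal ((A / w / 8) ^ 2 * (2 * a))) x := by
    intro x
    by_cases hx : x ∈ Set.Icc 0 (m * w)
    · rw [Set.indicator_of_mem hx, score_tiltedDensity_of_mem ha hw hA hA' haw θ hx]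
      refine le_trans (ENNReal.ofReal_le_ofReal ?_) le_add_self
      refine mul_le_mul ?_ (tiltedDensity_le ha hw hA hA' haw θ x) (hpos x).le (by positivity)
      rw [← sq_abs]
      exact pow_le_pow_left₀ (abs_nonneg _) (abs_mul_signSum_bumpDeriv_le hw hA θ _) 2
    · have hx' : x ∉ ⋃ j : Fin m, bin w j := fun h => hx
        (Set.iUnion_subset (fun j => bin_subset_Icc hw j) h)
      rw [Set.indicator_of_notMem hx, add_zero, score_tiltedDensity ha hw hA hA' haw,
        signSum_div_eq_zero hw (fun u => bumpDeriv_eq_zero) θ hx', mul_zero, add_zero,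
        ← ENNReal.ofReal_mul (by positivity)]
      refine ENNReal.ofReal_le_ofReal (mul_le_mul_of_nonneg_right ?_ (hpos x).le)
      rw [← sq_abs]
      exact pow_le_pow_left₀ (abs_nonneg _) (abs_baseScore_le ha.le _) 2
  refine (lintegral_mono hpt).trans ?_
  rw [lintegral_add_left ((hdens.1.ennreal_ofReal).const_mul _),
    lintegral_const_mul' _ _ (by simp), hdens.2.2, mul_one, lintegral_indicator measurableSet_Icc,
    setLIntegral_const, Real.volume_Icc, sub_zero, ← ENNReal.ofReal_mul (by positivity),
    ← ENNReal.ofReal_add (by positivity) (by positivity)]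
  apply ENNReal.ofReal_le_ofReal
  have : 0 ≤ (A / w) ^ 2 * (a * (m * w)) := by positivity
  linarith

omit ha hw hA hA' in
/-- A function that is both bounded and Lipschitz with constant `C` is Hölder with constant `C` for
every exponent between zero and one. -/
theorem le_mul_rpow_of_le_of_le_mul {C d D γ : ℝ} (hC : 0 ≤ C) (hd : 0 ≤ d) (hγ : 0 ≤ γ)
    (hγ' : γ ≤ 1) (h1 : D ≤ C) (h2 : D ≤ C * d) : D ≤ C * d ^ γ := by
  rcases le_total d 1 with h | h
  · refine h2.trans (mul_le_mul_of_nonneg_left ?_ hC)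
    simpa using Real.rpow_le_rpow_of_exponent_ge' hd h hγ hγ'
  · exact h1.trans (le_mul_of_one_le_right hC (Real.one_le_rpow h hγ))

/-- The base score lives on the length scale 1/a and the tilt on the scale w. Each is bounded and
Lipschitz on its own scale, hence Hölder there, and each receives half of the constant L. -/
theorem tiltedDensity_mem_holderScoreFisherClass {β L r : ℝ} (hβ : 1 ≤ β) (hβ' : β ≤ 2)
    (haw : a * (m * w) ≤ 1 / 4) (haL : 4 * a ^ β ≤ L) (hAL : 12 * A ≤ L * w ^ β)
    (hr : a ^ 2 + (A / w) ^ 2 * (a * (m * w)) ≤ r) (θ : Fin m → Bool) :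
    tiltedDensity a w A θ ∈ holderScoreFisherClass β L r := by
  refine ⟨⟨isDensity_tiltedDensity ha hw hA hA' haw θ, tiltedDensity_pos ha hw hA hA' haw θ,
    locallyAbsCont_tiltedDensity ha hw hA hA' haw θ,
    fun _ x => (hasDerivAt_log_tiltedDensity ha hw hA hA' haw θ x).differentiableAt,
    fun x y _ _ => ?_⟩, (fisherInfo_tiltedDensity_le ha hw hA hA' haw θ).trans
      (ENNReal.ofReal_le_ofReal hr)⟩
  rw [score_tiltedDensity ha hw hA hA' haw, score_tiltedDensity ha hw hA hA' haw]
  have hγ : 0 ≤ β - 1 := by linarith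
  have hγ' : β - 1 ≤ 1 := by linarith
  have hA0 : 0 < A / w := by positivity
  have h1 : |baseScore a (tailPart (m * w) x) - baseScore a (tailPart (m * w) y)| ≤
      2 * a * (a * |x - y|) ^ (β - 1) := by
    refine le_mul_rpow_of_le_of_le_mul (by positivity) (by positivity) hγ hγ' ?_ ?_
    · have h3 := abs_le.1 (abs_baseScore_le ha.le (tailPart (m * w) x))
      have h4 := abs_le.1 (abs_baseScore_le ha.le (tailPart (m * w) y))
      exact abs_le.2 ⟨by linarith, by linarith⟩
    · refine (abs_baseScore_sub_le a _ _).trans ?_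
      have := abs_tailPart_sub_le (by positivity : 0 ≤ m * w) x y
      calc _ ≤ 2 * a ^ 2 * |x - y| := by gcongr
        _ = _ := by ring
  have h2 : |A / w * signSum bumpDeriv θ (x / w) - A / w * signSum bumpDeriv θ (y / w)| ≤
      6 * (A / w) * (|x - y| / w) ^ (β - 1) := by
    refine le_mul_rpow_of_le_of_le_mul (by positivity) (by positivity) hγ hγ' ?_ ?_
    · have h3 := abs_le.1 (abs_mul_signSum_bumpDeriv_le hw hA θ (x / w))
      have h4 := abs_le.1 (abs_mul_signSum_bumpDeriv_le hw hA θ (y / w))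
      exact abs_le.2 ⟨by linarith, by linarith⟩
    · have := abs_signSum_sub_le (fun u => bumpDeriv_eq_zero) (by norm_num : (0 : ℝ) ≤ 3)
        abs_bumpDeriv_sub_le θ (x / w) (y / w)
      rw [← mul_sub, abs_mul, abs_of_pos hA0]
      rw [← sub_div, abs_div, abs_of_pos hw] at this
      calc _ ≤ A / w * (2 * 3 * (|x - y| / w)) := by gcongr
        _ = _ := by ring
  have e1 : 2 * a * (a * |x - y|) ^ (β - 1) = 2 * a ^ β * |x - y| ^ (β - 1) := by
    rw [Real.mul_rpow ha.le (abs_nonneg _), Real.rpow_sub_one ha.ne']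
    field_simp
  have e2 : 6 * (A / w) * (|x - y| / w) ^ (β - 1) = 6 * A / w ^ β * |x - y| ^ (β - 1) := by
    rw [Real.div_rpow (abs_nonneg _) hw.le, Real.rpow_sub_one hw.ne']
    have := (Real.rpow_pos_of_pos hw β).ne'
    field_simp
  have h3 : 6 * A / w ^ β ≤ L / 2 := by
    rw [div_le_iff₀ (Real.rpow_pos_of_pos hw β)]
    linarith
  rw [e1] at h1
  rw [e2] at h2
  have h4 : 0 ≤ |x - y| ^ (β - 1) := by positivity
  calc _ ≤ |baseScore a (tailPart (m * w) x) - baseScore a (tailPart (m * w) y)| +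
      |A / w * signSum bumpDeriv θ (x / w) - A / w * signSum bumpDeriv θ (y / w)| := by
        rw [add_sub_add_comm]
        exact abs_add_le _ _
    _ ≤ L / 2 * |x - y| ^ (β - 1) + L / 2 * |x - y| ^ (β - 1) := by
        refine add_le_add (h1.trans ?_) (h2.trans ?_)
        · gcongr
          linarith
        · gcongr
    _ = _ := by ring

end tilted
-- Affinity of tilted densities and the two lower bounds
-- The hypothesis bounds (√f - √g)² by K on B and by 0 elsewhere; integrating it gives the claim, as
-- f + g has mass 2.
theorem ofReal_le_lintegral_sqrt_mul {f g : ℝ → ℝ} (hf : IsDensity f) (hg : IsDensity g)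
    {K v : ℝ} (hK : 0 ≤ K) (hv : 0 ≤ v) {B : Set ℝ} (hB : MeasurableSet B)
    (hBv : volume B ≤ ENNReal.ofReal v)
    (h : ∀ x, f x + g x ≤ 2 * √(f x * g x) + B.indicator (fun _ => K) x) :
    ENNReal.ofReal (1 - K * v / 2) ≤ ∫⁻ x, ENNReal.ofReal (√(f x * g x)) := by
  set I := ∫⁻ x, ENNReal.ofReal (√(f x * g x)) with hI
  have h1 : ENNReal.ofReal 2 ≤ ENNReal.ofReal 2 * I + ENNReal.ofReal (K * v) := by
    calc ENNReal.ofReal 2 = ∫⁻ x, (ENNReal.ofReal (f x) + ENNReal.ofReal (g x)) := by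
          rw [lintegral_add_left hf.1.ennreal_ofReal, hf.2.2, hg.2.2, ENNReal.ofReal_ofNat,
            one_add_one_eq_two]
      _ ≤ ∫⁻ x, (ENNReal.ofReal 2 * ENNReal.ofReal (√(f x * g x)) +
          B.indicator (fun _ => ENNReal.ofReal K) x) := by
          refine lintegral_mono fun x => ?_
          rw [← ENNReal.ofReal_add (hf.2.1 x) (hg.2.1 x), ← ENNReal.ofReal_mul zero_le_two]
          refine (ENNReal.ofReal_le_ofReal (h x)).trans (ENNReal.ofReal_add_le.trans_eq ?_)
          congr 1
          by_cases hx : x ∈ B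
          · rw [Set.indicator_of_mem hx, Set.indicator_of_mem hx]
          · rw [Set.indicator_of_notMem hx, Set.indicator_of_notMem hx, ENNReal.ofReal_zero]
      _ ≤ _ := by
          rw [lintegral_add_right _ (measurable_const.indicator hB),
            lintegral_const_mul' _ _ (by simp), lintegral_indicator hB, setLIntegral_const,
            ENNReal.ofReal_mul hK]
          gcongr
  by_cases hIt : I = ⊤
  · rw [hIt]
    exact le_top
  · rw [← ENNReal.ofReal_toReal hIt, ← ENNReal.ofReal_mul zero_le_two,
      ← ENNReal.ofReal_add (by positivity) (by positivity),
      ENNReal.ofReal_le_ofReal_iff (by positivity)] at h1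
    rw [← ENNReal.ofReal_toReal hIt]
    apply ENNReal.ofReal_le_ofReal
    linarith

section tilted

variable {a w A : ℝ} {m : ℕ} (ha : 0 < a) (hw : 0 < w) (hA : 0 < A) (hA' : A ≤ 1)

include ha hw hA hA'

/-- Two tilted densities that agree off a set of measure `v` have Hellinger affinity at least
`1 - a A² v / 2`. -/
theorem affinity_tiltedDensity (haw : a * (m * w) ≤ 1 / 4) {θ θ' : Fin m → Bool} {v : ℝ}
    (hv : 0 ≤ v) {B : Set ℝ} (hB : MeasurableSet B) (hBv : volume B ≤ ENNReal.ofReal v)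
    (h : ∀ x ∉ B, signSum bump θ (x / w) = signSum bump θ' (x / w)) :
    ENNReal.ofReal (1 - a * A ^ 2 * v / 2) ≤
      ∫⁻ x, ENNReal.ofReal (√(tiltedDensity a w A θ x * tiltedDensity a w A θ' x)) := by
  have hZ := tiltedMass_pos ha hw hA hA' haw
  have hZ' := (tiltedMass_bounds ha hw hA hA' haw).1
  refine ofReal_le_lintegral_sqrt_mul (isDensity_tiltedDensity ha hw hA hA' haw θ)
    (isDensity_tiltedDensity ha hw hA hA' haw θ') (by positivity) hv hB hBv fun x => ?_
  set s := A * signSum bump θ (x / w) with hs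
  set t := A * signSum bump θ' (x / w) with ht
  set b := baseFun a (m * w) x / tiltedMass a w A m with hb
  have hb0 : 0 < b := div_pos (baseFun_pos _ _ _) hZ
  have e1 : tiltedDensity a w A θ x = b * Real.exp (s / 2) ^ 2 := by
    rw [tiltedDensity, tiltedFun, ← hs, hb, ← Real.exp_nat_mul]
    push_cast
    rw [mul_div_cancel₀ s two_ne_zero]
    ring
  have e2 : tiltedDensity a w A θ' x = b * Real.exp (t / 2) ^ 2 := by
    rw [tiltedDensity, tiltedFun, ← ht, hb, ← Real.exp_nat_mul]
    push_cast
    rw [mul_div_cancel₀ t two_ne_zero]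
    ring
  have e3 : √(tiltedDensity a w A θ x * tiltedDensity a w A θ' x) =
      b * (Real.exp (s / 2) * Real.exp (t / 2)) := by
    rw [e1, e2, Real.sqrt_eq_iff_mul_self_eq (by positivity) (by positivity)]
    ring
  rw [e3, e1, e2]
  by_cases hx : x ∈ B
  · rw [Set.indicator_of_mem hx]
    have hsb := abs_mul_signSum_bump_le hA θ (x / w)
    have htb := abs_mul_signSum_bump_le hA θ' (x / w)
    have hsb' : |s / 2| ≤ A / 32 := by
      rw [abs_div, abs_two]
      linarith
    have htb' : |t / 2| ≤ A / 32 := by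
      rw [abs_div, abs_two]
      linarith
    have h1 := abs_le.1 (Real.abs_exp_sub_one_le (by linarith : |s / 2| ≤ 1))
    have h2 := abs_le.1 (Real.abs_exp_sub_one_le (by linarith : |t / 2| ≤ 1))
    -- Both exponentials lie within A/16 of 1, since |exp x - 1| ≤ 2|x| for |x| ≤ 1.
    have h3 : (Real.exp (s / 2) - Real.exp (t / 2)) ^ 2 ≤ A ^ 2 := by
      rw [← sq_abs]
      refine pow_le_pow_left₀ (abs_nonneg _) (abs_le.2 ⟨?_, ?_⟩) 2 <;> linarith
    have h4 : b ≤ a := by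
      rw [hb, div_le_iff₀ hZ]
      have h5 : a * (1 / a) ≤ a * tiltedMass a w A m := by gcongr
      rw [mul_one_div_cancel ha.ne'] at h5
      exact (baseFun_le_one _ _ _).trans h5
    have h6 : b * (Real.exp (s / 2) - Real.exp (t / 2)) ^ 2 ≤ a * A ^ 2 := by gcongr
    linarith
  · rw [Set.indicator_of_notMem hx, hs, ht, h x hx]
    exact le_of_eq (by ring)

omit hA' in
theorem lintegral_bin_score_sq (j : Fin m) :
    ∫⁻ x in bin w j, ENNReal.ofReal
        (a / 28 * (A / w * signSum bumpDeriv (fun _ : Fin m => true) (x / w)) ^ 2) =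
      ENNReal.ofReal (a * A ^ 2 / (4410 * w)) := by
  have e : ∀ x ∈ bin w j, ENNReal.ofReal
      (a / 28 * (A / w * signSum bumpDeriv (fun _ : Fin m => true) (x / w)) ^ 2) =
      (fun u => ENNReal.ofReal (a / 28 * (A / w) ^ 2) * ENNReal.ofReal (bumpDeriv u ^ 2))
        (x / w - (j : ℕ)) := by
    intro x hx
    simp only
    rw [signSum_div_eq_of_mem_bin hw (fun u => bumpDeriv_eq_zero) _ hx, cond_true, one_mul, mul_pow,
      ← mul_assoc, ENNReal.ofReal_mul (by positivity)]
  rw [setLIntegral_congr_fun (measurableSet_bin w j) e, setLIntegral_bin_comp hw j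
    fun u => ENNReal.ofReal (a / 28 * (A / w) ^ 2) * ENNReal.ofReal (bumpDeriv u ^ 2),
    lintegral_const_mul' _ _ (by simp), lintegral_bumpDeriv_sq, ← ENNReal.ofReal_mul (by positivity),
    ← ENNReal.ofReal_mul hw.le]
  congr 1
  field_simp
  norm_num

/-- Independent signs on the bins: every estimator of the score has a loss of order
`a A² m / w` with probability at least `4 / 15`. -/
theorem ScoreEstimator.exists_tiltedDensity_of_bins (hm : 0 < m) (haw : a * (m * w) ≤ 1 / 4)
    {n : ℕ} (hn : n * (a * A ^ 2 * w) ≤ 1 / 16) (ψ : ScoreEstimator n) (t : ℝ≥0)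
    (ht : (t : ℝ≥0∞) < ENNReal.ofReal (a * A ^ 2 * m / (70560 * w))) :
    ∃ θ : Fin m → Bool, (sampleLaw n (tiltedDensity a w A θ)).real
      {X | ψ.loss (tiltedDensity a w A θ) X ≤ t} ≤ 11 / 15 := by
  have hm' : (0 : ℝ) < m := by exact_mod_cast hm
  have hwm : w ≤ m * w := by
    have : (1 : ℝ) ≤ m := by exact_mod_cast hm
    nlinarith
  have hρ : 0 ≤ 1 - a * A ^ 2 * w / 2 := by
    have h1 : a * w ≤ 1 / 4 := le_trans (by gcongr) haw
    have h2 : A ^ 2 ≤ 1 := pow_le_one₀ hA.le hA'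
    have h3 : A ^ 2 * (a * w) ≤ 1 * (1 / 4) := by gcongr
    linarith
  have hbern : 31 / 32 ≤ (1 - a * A ^ 2 * w / 2) ^ n := by
    have := one_add_mul_le_pow (a := -(a * A ^ 2 * w / 2)) (by linarith) n
    rw [← sub_eq_add_neg] at this
    linarith
  -- With affinity power at least 31/32 and l = 1/2, the testing bound reads 31/16 ≤ 1 + 3α/2, so α
  -- ≥ 5/8.
  have hα : ∀ (θ : Fin m → Bool) (j : Fin m) (S : Set (Fin n → ℝ)), MeasurableSet S → 5 / 8 ≤
      (sampleLaw n (tiltedDensity a w A θ)).real S +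
      (sampleLaw n (tiltedDensity a w A (Function.update θ j (!θ j)))).real Sᶜ := by
    intro θ j S hS
    have haff := affinity_tiltedDensity ha hw hA hA' haw (θ := θ)
      (θ' := Function.update θ j (!θ j)) hw.le (measurableSet_bin w j) (volume_bin w j).le
      fun x hx => by
        refine Finset.sum_congr rfl fun i _ => ?_
        by_cases hij : i = j
        · rw [hij, bump_eq_zero (mt (mem_bin hw).2 hx), mul_zero, mul_zero]
        · rw [Function.update_of_ne hij]
    have := affinity_pow_le_test_errors (isDensity_tiltedDensity ha hw hA hA' haw θ)
      (isDensity_tiltedDensity ha hw hA hA' haw (Function.update θ j (!θ j))) hρ haff n hS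
      (l := 1 / 2) (by norm_num)
    norm_num at this
    linarith
  have hsg : ∀ (θ : Fin m → Bool) (j : Fin m), ∀ x ∈ bin w j,
      score (tiltedDensity a w A θ) x = (bif θ j then 1 else -1) *
        (A / w * signSum bumpDeriv (fun _ : Fin m => true) (x / w)) := by
    intro θ j x hx
    rw [score_tiltedDensity_of_mem ha hw hA hA' haw θ (bin_subset_Icc hw j hx),
      signSum_div_eq_of_mem_bin hw (fun u => bumpDeriv_eq_zero) _ hx,
      signSum_div_eq_of_mem_bin hw (fun u => bumpDeriv_eq_zero) _ hx, cond_true, one_mul]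
    ring
  have hgm : Measurable fun x : ℝ =>
      A / w * signSum bumpDeriv (fun _ : Fin m => true) (x / w) :=
    (((continuous_signSum continuous_bumpDeriv _).measurable).comp
      (measurable_id.div_const w)).const_mul _
  -- The expected fraction of errors is at least 5/16. Asking only for a sixteenth of them leaves
  -- the probability bound (11/16)/(15/16) = 11/15 < 3/4.
  have hk : (t : ℝ≥0∞) < ENNReal.ofReal (a * A ^ 2 / (4410 * w)) * (⌈(m : ℝ) / 16⌉₊ : ℕ) := by
    refine ht.trans_le ?_
    rw [← ENNReal.ofReal_natCast, ← ENNReal.ofReal_mul (by positivity)]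
    apply ENNReal.ofReal_le_ofReal
    calc _ = a * A ^ 2 / (4410 * w) * (m / 16) := by
          field_simp
          norm_num
      _ ≤ _ := by
          gcongr
          exact Nat.le_ceil _
  obtain ⟨θ, hθ⟩ := ψ.exists_sampleLaw_loss_le (f := fun θ : Fin m → Bool => tiltedDensity a w A θ)
    (B := fun j : Fin m => bin w j) (by positivity : 0 ≤ a / 28)
    (fun θ => isDensity_tiltedDensity ha hw hA hA' haw θ) hgm (fun j => measurableSet_bin w j)
    (pairwise_disjoint_bin hw m)
    (fun θ j x hx => le_tiltedDensity ha hw hA hA' haw θ (bin_subset_Icc hw j hx)) hsg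
    (fun j => (lintegral_bin_score_sq ha hw hA j).ge) hα _ t hk
  refine ⟨θ, ?_⟩
  have hceil : (⌈(m : ℝ) / 16⌉₊ : ℝ) < m / 16 + 1 := Nat.ceil_lt_add_one (by positivity)
  set p := (sampleLaw n (tiltedDensity a w A θ)).real {X | ψ.loss (tiltedDensity a w A θ) X ≤ t}
  have hp : 0 ≤ p := measureReal_nonneg
  rw [Fintype.card_fin] at hθ
  have h1 : 15 / 16 * m * p ≤ ((m : ℝ) + 1 - ⌈(m : ℝ) / 16⌉₊) * p := by
    gcongr
    linarith
  have h2 : m * (15 / 16 * p) ≤ m * (11 / 16) := by linarith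
  have h3 := le_of_mul_le_mul_left h2 hm'
  linarith

/-- All signs equal: every estimator of the score has a loss of order `a A² m / w` with probability
larger than `δ`. -/
theorem ScoreEstimator.exists_tiltedDensity_of_two_points (haw : a * (m * w) ≤ 1 / 4)
    {n : ℕ} {δ : ℝ} (hδ : 0 < δ) (hδ' : δ < 1 / 16)
    (hn : 4 * (n * (a * A ^ 2 * (m * w))) ≤ Real.log (1 / δ)) (ψ : ScoreEstimator n) (t : ℝ≥0)
    (ht : (t : ℝ≥0∞) < ENNReal.ofReal (a * A ^ 2 * m / (4410 * w))) :
    ∃ θ : Fin m → Bool, (sampleLaw n (tiltedDensity a w A θ)).real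
      {X | ψ.loss (tiltedDensity a w A θ) X ≤ t} < 1 - δ := by
  set B : Set ℝ := ⋃ j : Fin m, bin w j with hB
  have hBm : MeasurableSet B := MeasurableSet.iUnion fun j => measurableSet_bin w j
  have hBs : B ⊆ Set.Icc 0 (m * w) := Set.iUnion_subset fun j => bin_subset_Icc hw j
  set y := a * A ^ 2 * (m * w) / 2 with hy
  have hy0 : 0 ≤ y := by positivity
  have hy1 : y ≤ 1 / 8 := by
    have h2 : A ^ 2 ≤ 1 := pow_le_one₀ hA.le hA'
    have h3 : A ^ 2 * (a * (m * w)) ≤ 1 * (1 / 4) := by gcongr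
    rw [hy]
    linarith
  have hρ : 0 < 1 - y := by linarith
  -- From (1 - y)(1 + 2y) ≥ 1, valid for 0 ≤ y ≤ 1/2.
  have hexp : Real.exp (-(2 * y)) ≤ 1 - y := by
    have h1 := Real.add_one_le_exp (2 * y)
    have h2 : Real.exp (-(2 * y)) * Real.exp (2 * y) = 1 := by
      rw [← Real.exp_add, neg_add_cancel, Real.exp_zero]
    have h3 := Real.exp_pos (-(2 * y))
    have h4 : (1 - y) * (2 * y + 1) ≤ (1 - y) * Real.exp (2 * y) := by gcongr
    have h5 : Real.exp (-(2 * y)) * Real.exp (2 * y) ≤ (1 - y) * Real.exp (2 * y) := by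
      rw [h2]
      nlinarith
    exact le_of_mul_le_mul_right h5 (Real.exp_pos _)
  set R := (1 - y) ^ n with hR
  have hR0 : 0 < R := pow_pos hρ n
  -- R² ≥ exp(-4ny) ≥ √δ, and √δ > 4δ because δ < 1/16.
  have hRδ : 4 * δ < R ^ 2 := by
    have h1 : √δ ≤ R ^ 2 := by
      calc √δ = Real.exp (-(Real.log (1 / δ) / 2)) := by
            rw [one_div, Real.log_inv, Real.sqrt_eq_rpow, Real.rpow_def_of_pos hδ]
            congr 1
            ring
        _ ≤ Real.exp (((n * 2 : ℕ) : ℝ) * -(2 * y)) := by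
            rw [Real.exp_le_exp]
            have hny : 8 * (n * y) ≤ Real.log (1 / δ) := by
              rw [hy]
              linarith
            push_cast
            linarith
        _ = Real.exp (-(2 * y)) ^ (n * 2) := Real.exp_nat_mul _ _
        _ ≤ (1 - y) ^ (n * 2) := pow_le_pow_left₀ (Real.exp_pos _).le hexp _
        _ = R ^ 2 := by rw [hR, pow_mul]
    have h2 : 0 < √δ := Real.sqrt_pos.2 hδ
    have h3 : √δ < 1 / 4 := by
      rw [Real.sqrt_lt' (by norm_num)]
      linarith
    have h4 : √δ * √δ = δ := Real.mul_self_sqrt hδ.le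
    nlinarith
  have hsgn : ∀ (b : Bool) (φ : ℝ → ℝ) (u : ℝ), signSum φ (fun _ : Fin m => b) u =
      (bif b then 1 else -1) * signSum φ (fun _ : Fin m => true) u := by
    intro b φ u
    simp only [signSum, Finset.mul_sum, cond_true, one_mul]
  -- The weight l = R/2 turns the testing bound into 2R² ≤ 2α + (R²/2)(2 - α), whence α ≥ R²/2. The
  -- cube has a single coordinate here.
  have hα : ∀ (θ : Unit → Bool) (j : Unit) (S : Set (Fin n → ℝ)), MeasurableSet S → R ^ 2 / 2 ≤
      (sampleLaw n (tiltedDensity a w A fun _ : Fin m => θ ())).real S +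
      (sampleLaw n (tiltedDensity a w A
        fun _ : Fin m => Function.update θ j (!θ j) ())).real Sᶜ := by
    intro θ j S hS
    have haff := affinity_tiltedDensity ha hw hA hA' haw (θ := fun _ => θ ())
      (θ' := fun _ => Function.update θ j (!θ j) ()) (by positivity : 0 ≤ m * w) hBm
      (volume_iUnion_bin hw m).le fun x hx => by
        rw [signSum_div_eq_zero hw (fun u => bump_eq_zero) _ hx,
          signSum_div_eq_zero hw (fun u => bump_eq_zero) _ hx]
    have := affinity_pow_le_test_errors (isDensity_tiltedDensity ha hw hA hA' haw fun _ => θ ())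
      (isDensity_tiltedDensity ha hw hA hA' haw fun _ => Function.update θ j (!θ j) ()) hρ.le haff n
      hS (l := R / 2) (by positivity)
    rw [← hR] at this
    set α := (sampleLaw n (tiltedDensity a w A fun _ : Fin m => θ ())).real S +
      (sampleLaw n (tiltedDensity a w A
        fun _ : Fin m => Function.update θ j (!θ j) ())).real Sᶜ with hαd
    have hα0 : 0 ≤ α := by positivity
    have h1 : R * (2 * R) ≤ R * ((R / 2)⁻¹ * α + R / 2 * (2 - α)) := by gcongr
    have h2 : R * ((R / 2)⁻¹ * α + R / 2 * (2 - α)) = 2 * α + R ^ 2 / 2 * (2 - α) := by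
      field_simp
    rw [h2] at h1
    nlinarith [mul_nonneg (sq_nonneg R) hα0]
  obtain ⟨j₀, hj₀⟩ | hm : (∃ _ : Fin m, True) ∨ m = 0 := by
    rcases Nat.eq_zero_or_pos m with h | h
    · exact Or.inr h
    · exact Or.inl ⟨⟨0, h⟩, trivial⟩
  · have hsep : ENNReal.ofReal (a * A ^ 2 * m / (4410 * w)) ≤ ∫⁻ x in B, ENNReal.ofReal
        (a / 28 * (A / w * signSum bumpDeriv (fun _ : Fin m => true) (x / w)) ^ 2) := by
      rw [hB, lintegral_iUnion (s := fun j : Fin m => bin w j) (fun j => measurableSet_bin w j)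
        (pairwise_disjoint_bin hw m), tsum_fintype]
      simp only [lintegral_bin_score_sq ha hw hA, Finset.sum_const, Finset.card_univ,
        Fintype.card_fin, nsmul_eq_mul]
      rw [← ENNReal.ofReal_natCast, ← ENNReal.ofReal_mul (by positivity)]
      exact le_of_eq (by congr 1; ring)
    have hgm : Measurable fun x : ℝ =>
        A / w * signSum bumpDeriv (fun _ : Fin m => true) (x / w) :=
      (((continuous_signSum continuous_bumpDeriv _).measurable).comp
        (measurable_id.div_const w)).const_mul _
    -- One sign and k = 1: the probability of a small loss is at most 1 - R²/4 < 1 - δ.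
    obtain ⟨θ, hθ⟩ := ψ.exists_sampleLaw_loss_le
      (f := fun θ : Unit → Bool => tiltedDensity a w A fun _ : Fin m => θ ())
      (B := fun _ => B) (by positivity : 0 ≤ a / 28)
      (fun θ => isDensity_tiltedDensity ha hw hA hA' haw _) hgm (fun _ => hBm)
      (fun i j hij => absurd (Subsingleton.elim i j) hij)
      (fun θ _ x hx => le_tiltedDensity ha hw hA hA' haw _ (hBs hx))
      (fun θ _ x hx => by
        rw [score_tiltedDensity_of_mem ha hw hA hA' haw _ (hBs hx), hsgn]
        ring) (fun _ => hsep) hα 1 t (by simpa using ht)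
    refine ⟨fun _ => θ (), ?_⟩
    simp only [Fintype.card_unit, Nat.cast_one, add_sub_cancel_right, one_mul] at hθ
    linarith
  · rw [hm] at ht
    simp at ht

end tilted
-- Choice of the parameters and the resulting rates
/-- The parameters `a = s / (4 σ)`, `w = 1 / (σ m)` and `A = m ^ (-β) / 12` with `σ ^ β = L` put all
tilted densities into the class with Fisher information at most `s ≤ σ ^ 2`. -/
theorem tiltedDensity_params {β L s σ : ℝ} (hβ : 1 ≤ β) (hβ' : β ≤ 2) (hs : 0 < s) (hσ : 0 < σ)
    (hσL : σ ^ β = L) (hsσ : s ≤ σ ^ 2) {m : ℕ} (hm : 0 < m) :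
    ∃ a w A : ℝ, 0 < a ∧ 0 < w ∧ 0 < A ∧ A ≤ 1 ∧ a * (m * w) ≤ 1 / 4 ∧
      (∀ θ : Fin m → Bool, tiltedDensity a w A θ ∈ holderScoreFisherClass β L s) ∧
      a * A ^ 2 * w = s / (576 * σ ^ 2 * (m : ℝ) ^ (2 * β + 1)) ∧
      a * A ^ 2 * (m * w) = s / (576 * σ ^ 2 * (m : ℝ) ^ (2 * β)) ∧
      a * A ^ 2 * m / w = s * (m : ℝ) ^ (2 - 2 * β) / 576 := by
  have hm0 : (0 : ℝ) < m := by exact_mod_cast hm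
  have hm1 : (1 : ℝ) ≤ m := by exact_mod_cast hm
  have hmβ : 0 < (m : ℝ) ^ β := Real.rpow_pos_of_pos hm0 β
  have hmβ1 : (m : ℝ) ≤ (m : ℝ) ^ β := by
    simpa using Real.rpow_le_rpow_of_exponent_le hm1 hβ
  have hm2β : (m : ℝ) ^ (2 * β) = ((m : ℝ) ^ β) ^ 2 := by
    rw [mul_comm, Real.rpow_mul hm0.le]
    norm_num
  have hA1 : ((m : ℝ) ^ β)⁻¹ ≤ 1 := inv_le_one_of_one_le₀ (hm1.trans hmβ1)
  have ha : 0 < s / (4 * σ) := by positivity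
  have hw : 0 < 1 / (σ * m) := by positivity
  have hA : 0 < ((m : ℝ) ^ β)⁻¹ / 12 := by positivity
  have hA' : ((m : ℝ) ^ β)⁻¹ / 12 ≤ 1 := by linarith
  have haw : s / (4 * σ) * (m * (1 / (σ * m))) ≤ 1 / 4 := by
    have e : s / (4 * σ) * (m * (1 / (σ * m))) = s / σ ^ 2 / 4 := by
      field_simp
    rw [e]
    have : s / σ ^ 2 ≤ 1 := (div_le_one (by positivity)).2 hsσ
    linarith
  refine ⟨s / (4 * σ), 1 / (σ * m), ((m : ℝ) ^ β)⁻¹ / 12, ha, hw, hA, hA', haw, fun θ =>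
    tiltedDensity_mem_holderScoreFisherClass ha hw hA hA' hβ hβ' haw ?_ ?_ ?_ θ, ?_, ?_, ?_⟩
  · have h1 : s / (4 * σ) ≤ σ / 4 := by
      rw [div_le_div_iff₀ (by positivity) (by norm_num)]
      nlinarith
    have h2 : (1 / 4 : ℝ) ^ β ≤ 1 / 4 := by
      simpa using Real.rpow_le_rpow_of_exponent_ge (by norm_num : (0 : ℝ) < 1 / 4) (by norm_num) hβ
    calc 4 * (s / (4 * σ)) ^ β ≤ 4 * (σ * (1 / 4)) ^ β := by
          gcongr
          linarith
      _ = 4 * (σ ^ β * (1 / 4) ^ β) := by rw [Real.mul_rpow hσ.le (by norm_num)]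
      _ ≤ 4 * (σ ^ β * (1 / 4)) := by gcongr
      _ = L := by
          rw [hσL]
          ring
  -- An equality: A is as large as the Hölder condition allows.
  · rw [Real.div_rpow zero_le_one (by positivity), Real.one_rpow, Real.mul_rpow hσ.le hm0.le, hσL]
    have hL : 0 < L := hσL ▸ Real.rpow_pos_of_pos hσ β
    apply le_of_eq
    field_simp
  -- A/w = σm^(1-β)/12 is at most σ/12, so the Fisher information is at most s/16 + s/576.
  · have h1 : ((m : ℝ) ^ β)⁻¹ / 12 / (1 / (σ * m)) ≤ σ / 12 := by
      have : m * ((m : ℝ) ^ β)⁻¹ ≤ 1 := by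
        rw [← div_eq_mul_inv]
        exact (div_le_one hmβ).2 hmβ1
      have e : ((m : ℝ) ^ β)⁻¹ / 12 / (1 / (σ * m)) = σ / 12 * (m * ((m : ℝ) ^ β)⁻¹) := by
        field_simp
      rw [e]
      exact mul_le_of_le_one_right (by positivity) this
    have e2 : s / (4 * σ) * (m * (1 / (σ * m))) = s / (4 * σ ^ 2) := by
      field_simp
    rw [e2]
    calc _ ≤ (s / (4 * σ)) ^ 2 + (σ / 12) ^ 2 * (s / (4 * σ ^ 2)) := by gcongr
      _ = s * (s / σ ^ 2) / 16 + s / 576 := by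
          field_simp
          ring
      _ ≤ s * 1 / 16 + s / 576 := by
          gcongr
          exact (div_le_one (by positivity)).2 hsσ
      _ ≤ s := by linarith
  · rw [Real.rpow_add_one hm0.ne', hm2β]
    field_simp
    norm_num
  · rw [hm2β]
    field_simp
    norm_num
  · rw [Real.rpow_sub hm0, hm2β]
    norm_num
    field_simp
    norm_num

/-- The number of bins can be taken of order `x ^ (-1 / p)`, or one if this is small. -/
theorem exists_nat_rpow_bounds {β x p : ℝ} (hβ : 1 ≤ β) (hβ' : β ≤ 2) (hx : 0 < x) (hp : 0 < p) :
    ∃ m : ℕ, 0 < m ∧ 1 ≤ x * (m : ℝ) ^ p ∧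
      1 / 4 * min (x ^ (2 * (β - 1) / p)) 1 ≤ (m : ℝ) ^ (2 - 2 * β) := by
  set y := x ^ (-(1 / p)) with hy
  have hy0 : 0 < y := Real.rpow_pos_of_pos hx _
  have hm : 0 < ⌈y⌉₊ := Nat.ceil_pos.2 hy0
  have hyp : y ^ p = x⁻¹ := by
    rw [hy, ← Real.rpow_mul hx.le, neg_mul, one_div_mul_cancel hp.ne', Real.rpow_neg_one]
  refine ⟨⌈y⌉₊, hm, ?_, ?_⟩
  · calc 1 = x * y ^ p := by rw [hyp, mul_inv_cancel₀ hx.ne']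
      _ ≤ _ := by
          gcongr
          exact Nat.le_ceil y
  · have hm0 : (0 : ℝ) < ⌈y⌉₊ := by exact_mod_cast hm
    have hle : (⌈y⌉₊ : ℝ) ≤ 2 * max y 1 := by
      have h1 := (Nat.ceil_lt_add_one hy0.le).le
      have h2 := le_max_left y 1
      have h3 := le_max_right y 1
      linarith
    have he : 2 - 2 * β ≤ 0 := by linarith
    -- Rounding up at most doubles max(y, 1), and the exponent 2 - 2β is at least -2.
    have h4 : (1 / 4 : ℝ) ≤ 2 ^ (2 - 2 * β) := by
      have h5 : (2 : ℝ) ^ (-2 : ℝ) ≤ 2 ^ (2 - 2 * β) :=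
        Real.rpow_le_rpow_of_exponent_le (by norm_num) (by linarith)
      refine le_trans (le_of_eq ?_) h5
      rw [Real.rpow_neg (by norm_num)]
      norm_num
    have h6 : min (x ^ (2 * (β - 1) / p)) 1 ≤ max y 1 ^ (2 - 2 * β) := by
      rcases le_total y 1 with h | h
      · rw [max_eq_right h, Real.one_rpow]
        exact min_le_right _ _
      · rw [max_eq_left h, hy, ← Real.rpow_mul hx.le]
        refine (min_le_left _ _).trans_eq ?_
        congr 1
        ring
    calc _ ≤ (2 : ℝ) ^ (2 - 2 * β) * max y 1 ^ (2 - 2 * β) := by gcongr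
      _ = (2 * max y 1) ^ (2 - 2 * β) := by rw [Real.mul_rpow (by norm_num) (by positivity)]
      _ ≤ _ := Real.rpow_le_rpow_of_nonpos hm0 hle he

theorem measure_lt_ofReal_of_real_lt {Ω : Type*} [MeasurableSpace Ω] {μ : Measure Ω}
    [IsFiniteMeasure μ] {s : Set Ω} {c : ℝ} (h : μ.real s < c) : μ s < ENNReal.ofReal c := by
  rw [← ofReal_measureReal]
  exact (ENNReal.ofReal_lt_ofReal_iff (measureReal_nonneg.trans_lt h)).2 h

section quantile

variable {β L s σ : ℝ} (hβ : 1 ≤ β) (hβ' : β ≤ 2) (hs : 0 < s) (hσ : 0 < σ)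
  (hσL : σ ^ β = L) (hsσ : s ≤ σ ^ 2) {n : ℕ} (hn : 0 < n) {δ : ℝ}

include hβ hβ' hs hσ hσL hsσ hn

/-- The constant is 576 · 4 · 70560: the parameters, the rounding of m, and the separation of a
sixteenth of the bins. -/
theorem nonparametric_le_minimaxQuantile (hδ : δ < 1 / 4) :
    ENNReal.ofReal (s / 162570240 *
      min ((σ ^ 2 / s * (1 / n)) ^ (2 * (β - 1) / (2 * β + 1))) 1) ≤
      minimaxQuantile n δ (holderScoreFisherClass β L s) := by
  have hn0 : (0 : ℝ) < n := by exact_mod_cast hn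
  obtain ⟨m, hm, h1, h2⟩ := exists_nat_rpow_bounds (x := σ ^ 2 / s * (1 / n)) (p := 2 * β + 1) hβ hβ'
    (by positivity) (by linarith)
  obtain ⟨a, w, A, ha, hw, hA, hA', haw, hmem, e1, -, e3⟩ :=
    tiltedDensity_params hβ hβ' hs hσ hσL hsσ hm
  have hm0 : (0 : ℝ) < m := by exact_mod_cast hm
  have hmp : 0 < (m : ℝ) ^ (2 * β + 1) := Real.rpow_pos_of_pos hm0 _
  have hinfo : n * (a * A ^ 2 * w) ≤ 1 / 16 := by
    have h3 : s * n ≤ σ ^ 2 * (m : ℝ) ^ (2 * β + 1) := by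
      have e : σ ^ 2 / s * (1 / n) * (m : ℝ) ^ (2 * β + 1) =
          σ ^ 2 * (m : ℝ) ^ (2 * β + 1) / (s * n) := by
        field_simp
      rwa [e, one_le_div (by positivity)] at h1
    rw [e1, ← mul_div_assoc, div_le_iff₀ (by positivity)]
    have h4 : 0 < s * n := by positivity
    linarith
  refine le_minimaxQuantile fun ψ t ht => ?_
  have ht' : (t : ℝ≥0∞) < ENNReal.ofReal (a * A ^ 2 * m / (70560 * w)) := by
    refine ht.trans_le (ENNReal.ofReal_le_ofReal ?_)
    have e : a * A ^ 2 * m / (70560 * w) = a * A ^ 2 * m / w / 70560 := by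
      field_simp
    rw [e, e3]
    have := mul_le_mul_of_nonneg_left h2 hs.le
    linarith
  obtain ⟨θ, hθ⟩ := ψ.exists_tiltedDensity_of_bins ha hw hA hA' hm haw hinfo t ht'
  have := (hmem θ).1.1.isProbabilityMeasure_sampleLaw n
  exact ⟨_, hmem θ, measure_lt_ofReal_of_real_lt (by linarith)⟩

theorem deviation_le_minimaxQuantile (hδ : 0 < δ) (hδ' : δ < 1 / 16) :
    ENNReal.ofReal (s / 162570240 *
      min ((σ ^ 2 / s * (Real.log (1 / δ) / n)) ^ ((β - 1) / β)) 1) ≤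
      minimaxQuantile n δ (holderScoreFisherClass β L s) := by
  have hn0 : (0 : ℝ) < n := by exact_mod_cast hn
  have hlog : 0 < Real.log (1 / δ) := Real.log_pos (by
    rw [lt_div_iff₀ hδ]
    linarith)
  have hp : 0 < 2 * β := by linarith
  obtain ⟨m, hm, h1, h2⟩ := exists_nat_rpow_bounds (x := σ ^ 2 / s * (Real.log (1 / δ) / n))
    (p := 2 * β) hβ hβ' (by positivity) hp
  rw [mul_div_mul_left _ _ two_ne_zero] at h2
  obtain ⟨a, w, A, ha, hw, hA, hA', haw, hmem, -, e2, e3⟩ :=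
    tiltedDensity_params hβ hβ' hs hσ hσL hsσ hm
  have hm0 : (0 : ℝ) < m := by exact_mod_cast hm
  have hmp : 0 < (m : ℝ) ^ (2 * β) := Real.rpow_pos_of_pos hm0 _
  have hinfo : 4 * (n * (a * A ^ 2 * (m * w))) ≤ Real.log (1 / δ) := by
    have h3 : s * n ≤ Real.log (1 / δ) * (σ ^ 2 * (m : ℝ) ^ (2 * β)) := by
      have e : σ ^ 2 / s * (Real.log (1 / δ) / n) * (m : ℝ) ^ (2 * β) =
          Real.log (1 / δ) * (σ ^ 2 * (m : ℝ) ^ (2 * β)) / (s * n) := by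
        field_simp
      rwa [e, one_le_div (by positivity)] at h1
    rw [e2, ← mul_div_assoc, ← mul_div_assoc, div_le_iff₀ (by positivity)]
    have h4 : 0 < s * n := by positivity
    linarith
  refine le_minimaxQuantile fun ψ t ht => ?_
  have ht' : (t : ℝ≥0∞) < ENNReal.ofReal (a * A ^ 2 * m / (4410 * w)) := by
    refine ht.trans_le (ENNReal.ofReal_le_ofReal ?_)
    have e : a * A ^ 2 * m / (4410 * w) = a * A ^ 2 * m / w / 4410 := by
      field_simp
    rw [e, e3]
    have := mul_le_mul_of_nonneg_left h2 hs.le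
    have h5 : 0 ≤ s * (m : ℝ) ^ (2 - 2 * β) := by positivity
    linarith
  obtain ⟨θ, hθ⟩ := ψ.exists_tiltedDensity_of_two_points ha hw hA hA' haw hδ hδ' hinfo t ht'
  have := (hmem θ).1.1.isProbabilityMeasure_sampleLaw n
  exact ⟨_, hmem θ, measure_lt_ofReal_of_real_lt hθ⟩

end quantile

theorem min_add_one_le {u v : ℝ} (hu : 0 ≤ u) (hv : 0 ≤ v) :
    min (u + v) 1 ≤ min u 1 + min v 1 := by
  rcases le_total u 1 with h | h
  · rcases le_total v 1 with h' | h'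
    · rw [min_eq_left h, min_eq_left h']
      exact min_le_left _ _
    · rw [min_eq_left h, min_eq_right h']
      exact (min_le_right _ _).trans (by linarith)
  · rw [min_eq_right h]
    exact (min_le_right _ _).trans (le_add_of_nonneg_right (le_min hv zero_le_one))

/-- For a bounded logarithmic factor the deviation term is dominated by the nonparametric rate. -/
theorem min_rpow_add_rpow_le {β x l : ℝ} (hβ : 1 ≤ β) (hx : 0 < x) (hl : 0 ≤ l)
    (hl' : l ≤ 3) :
    min (x ^ (2 * (β - 1) / (2 * β + 1)) + (x * l) ^ ((β - 1) / β)) 1 ≤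
      4 * min (x ^ (2 * (β - 1) / (2 * β + 1))) 1 := by
  have hβ0 : 0 < β := by linarith
  have he : 0 ≤ 2 * (β - 1) / (2 * β + 1) := div_nonneg (by linarith) (by linarith)
  have he' : 0 ≤ (β - 1) / β := div_nonneg (by linarith) hβ0.le
  rcases le_total x 1 with h | h
  · have h0 : x ^ (2 * (β - 1) / (2 * β + 1)) ≤ 1 := Real.rpow_le_one hx.le h he
    -- For x ≤ 1 the larger exponent (β - 1)/β = 2(β - 1)/(2β) gives the smaller power.
    have h1 : x ^ ((β - 1) / β) ≤ x ^ (2 * (β - 1) / (2 * β + 1)) := by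
      refine Real.rpow_le_rpow_of_exponent_ge hx h ?_
      rw [div_le_div_iff₀ (by linarith) hβ0]
      nlinarith
    have h2 : l ^ ((β - 1) / β) ≤ 3 := by
      calc l ^ ((β - 1) / β) ≤ 3 ^ ((β - 1) / β) := by gcongr
        _ ≤ (3 : ℝ) ^ (1 : ℝ) := by
            refine Real.rpow_le_rpow_of_exponent_le (by norm_num) ?_
            rw [div_le_one hβ0]
            linarith
        _ = 3 := Real.rpow_one 3
    rw [min_eq_left h0, Real.mul_rpow hx.le hl]
    refine (min_le_left _ _).trans ?_
    have h3 : x ^ ((β - 1) / β) * l ^ ((β - 1) / β) ≤ x ^ (2 * (β - 1) / (2 * β + 1)) * 3 := by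
      gcongr
    linarith
  · rw [min_eq_right (Real.one_le_rpow h he)]
    exact (min_le_right _ _).trans (by norm_num)

theorem holderScoreFisherClass_mono (β L : ℝ) {s r : ℝ} (h : s ≤ r) :
    holderScoreFisherClass β L s ⊆ holderScoreFisherClass β L r :=
  fun _ hf => ⟨hf.1, hf.2.trans (ENNReal.ofReal_le_ofReal h)⟩

theorem minimaxQuantile_mono (n : ℕ) (δ : ℝ) {G H : Set (ℝ → ℝ)} (h : G ⊆ H) :
    minimaxQuantile n δ G ≤ minimaxQuantile n δ H :=
  iInf_mono fun _ => biSup_mono h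

theorem proposition6 (β : ℝ) (hβ : 1 ≤ β) (hβ' : β ≤ 2) :
    ∃ c : ℝ, 0 < c ∧ ∀ (L r : ℝ), 0 < L → 0 < r → ∀ r' : ℝ, r' = min r (L ^ (2 / β)) →
      ∀ n : ℕ, 1 ≤ n →
        (∀ δ : ℝ, 0 < δ → δ < 1 / 4 →
          ENNReal.ofReal (c * (r' * min
            ((L ^ (2 / β) / r' * (1 / (n : ℝ))) ^ (2 * (β - 1) / (2 * β + 1)) +
              (L ^ (2 / β) / r' * (Real.log (1 / δ) / (n : ℝ))) ^ ((β - 1) / β)) 1))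
            ≤ minimaxQuantile n δ (holderScoreFisherClass β L r)) ∧
        ENNReal.ofReal (c * (r' * min
            ((L ^ (2 / β) / r' * (1 / (n : ℝ))) ^ (2 * (β - 1) / (2 * β + 1))) 1))
          ≤ minimaxRisk n (holderScoreFisherClass β L r) := by
  -- Five times the earlier constant: 5 pays for Markov's inequality at δ = 1/5, and also covers the
  -- factor 2 for a sum of two terms and the factor 4 from `min_rpow_add_rpow_le`.
  refine ⟨1 / 812851200, by norm_num, fun L r hL hr r' hr' n hn => ?_⟩
  have hβ0 : 0 < β := by linarith
  have hn0 : (0 : ℝ) < n := by exact_mod_cast hn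
  set σ := L ^ (1 / β) with hσd
  have hσ : 0 < σ := Real.rpow_pos_of_pos hL _
  have hσL : σ ^ β = L := by
    rw [hσd, ← Real.rpow_mul hL.le, one_div_mul_cancel hβ0.ne', Real.rpow_one]
  have hσ2 : L ^ (2 / β) = σ ^ 2 := by
    rw [hσd, ← Real.rpow_natCast, ← Real.rpow_mul hL.le]
    congr 1
    push_cast
    ring
  rw [hσ2] at hr' ⊢
  have hs : 0 < r' := hr' ▸ lt_min hr (by positivity)
  have hsσ : r' ≤ σ ^ 2 := hr' ▸ min_le_right _ _
  have hsr : r' ≤ r := hr' ▸ min_le_left _ _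
  set x := σ ^ 2 / r' * (1 / (n : ℝ)) with hx
  have hx0 : 0 < x := by positivity
  set u := x ^ (2 * (β - 1) / (2 * β + 1)) with hu
  have hu0 : 0 ≤ u := by positivity
  have hmono : ∀ δ, minimaxQuantile n δ (holderScoreFisherClass β L r') ≤
      minimaxQuantile n δ (holderScoreFisherClass β L r) := fun δ =>
    minimaxQuantile_mono n δ (holderScoreFisherClass_mono β L hsr)
  have hnp : ∀ δ : ℝ, δ < 1 / 4 → ENNReal.ofReal (r' / 162570240 * min u 1) ≤
      minimaxQuantile n δ (holderScoreFisherClass β L r) := fun δ hδ =>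
    (nonparametric_le_minimaxQuantile hβ hβ' hs hσ hσL hsσ hn hδ).trans (hmono δ)
  constructor
  · intro δ hδ hδ'
    have hlog : 0 < Real.log (1 / δ) := Real.log_pos (by
      rw [lt_div_iff₀ hδ]
      linarith)
    have hv0 : 0 ≤ (σ ^ 2 / r' * (Real.log (1 / δ) / n)) ^ ((β - 1) / β) := by positivity
    rcases lt_or_ge δ (1 / 16) with h | h
    · have hdev := (deviation_le_minimaxQuantile hβ hβ' hs hσ hσL hsσ hn hδ h).trans (hmono δ)
      set v := (σ ^ 2 / r' * (Real.log (1 / δ) / n)) ^ ((β - 1) / β)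
      have hadd := mul_le_mul_of_nonneg_left (min_add_one_le hu0 hv0) hs.le
      have hu1 : 0 ≤ r' * min u 1 := mul_nonneg hs.le (le_min hu0 zero_le_one)
      have hv1 : 0 ≤ r' * min v 1 := mul_nonneg hs.le (le_min hv0 zero_le_one)
      rcases le_total (r' * min u 1) (r' * min v 1) with h' | h'
      · refine le_trans (ENNReal.ofReal_le_ofReal ?_) hdev
        linarith
      · refine le_trans (ENNReal.ofReal_le_ofReal ?_) (hnp δ hδ')
        linarith
    -- For δ ≥ 1/16, log(1/δ) ≤ 4 log 2 < 3, so the first rate alone suffices.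
    · have hlog3 : Real.log (1 / δ) ≤ 3 := by
        have h1 : 1 / δ ≤ 2 ^ 4 := by
          rw [div_le_iff₀ hδ]
          linarith
        have h2 := Real.log_le_log (by positivity) h1
        rw [Real.log_pow] at h2
        have h3 := Real.log_two_lt_d9
        push_cast at h2
        linarith
      have hdom := mul_le_mul_of_nonneg_left
        (min_rpow_add_rpow_le hβ hx0 hlog.le hlog3) hs.le
      have e : x * Real.log (1 / δ) = σ ^ 2 / r' * (Real.log (1 / δ) / n) := by
        rw [hx]
        ring
      rw [e] at hdom
      have hu1 : 0 ≤ r' * min u 1 := mul_nonneg hs.le (le_min hu0 zero_le_one)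
      refine le_trans (ENNReal.ofReal_le_ofReal ?_) (hnp δ hδ')
      linarith
  · refine le_trans ?_ (ofReal_mul_minimaxQuantile_le_minimaxRisk (δ := 1 / 5) (by norm_num)
      (by norm_num) fun f hf => hf.1.1)
    refine le_trans (le_of_eq ?_) (mul_le_mul_right (hnp (1 / 5) (by norm_num)) _)
    rw [← ENNReal.ofReal_mul (by norm_num)]
    congr 1
    ring
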